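/- All orders are quasi-orders. For a well-quasi-order (wqo) $A$, the maximal order type $\mathbf{o}(A)$ is the rank of the well-founded tree of finite bad sequences of $A$ (sequences $x_1,\dots,x_n$ with no $i<j$ such that $x_i\le x_j$), and the width $\mathbf{w}(A)$ is the rank of the tree of finite sequences of pairwise incomparable elements of $A$. Both trees are ordered by inverse prefix order; the rank of a node is the supremum of $r+1$ over the ranks $r$ of the nodes strictly below it, and the rank of a tree is the rank of its root, the empty sequence. Let $\mathsf{P_f}(A)$ be the set of finite subsets of $A$ with $S\le T\iff\forall a\in S\,\exists b\in T\; a\le b$. Let $\Gamma_k$ be the antichain with $k$ elements, $\sqcup$ the disjoint sum, $\sum_{\beta<\gamma}$ the lexicographic sum, and $A\cdot B$ the lexicographic product: the set $A\times B$ with $(a,b)\le(a',b')$ iff $b\le b'$ and ($b\equiv b'$ implies $a\le a'$), where $b\equiv b'$ means $b\le b'\le b$. Define $H_{\omega^\gamma}$ by recursion on the ordinal $\gamma$: * $H_{\omega^0}=\Gamma_1$ and $H_{\omega^1}=\sum_{n<\omega}\Gamma_n$; * $H_{\omega^{\omega^a}}=\sum_{\beta<\omega^a}H_{\omega^\beta}$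 for $a>0$; * $H_{\omega^\gamma}=H_{\omega^{\omega^{\gamma_1}}}\cdots H_{\omega^{\omega^{\gamma_n}}}$ (lexicographic product) for $\gamma=\omega^{\gamma_1}+\dots+\omega^{\gamma_n}$ in Cantor normal form ($\gamma_1\ge\dots\ge\gamma_n$) with $n>1$. For an arbitrary ordinal with Cantor normal form $\alpha=\omega^{\alpha_1}+\dots+\omega^{\alpha_n}$, $\alpha_1\ge\dots\ge\alpha_n$, put $H_\alpha=H_{\omega^{\alpha_1}}\sqcup\dots\sqcup H_{\omega^{\alpha_n}}$ (so $H_0=\emptyset$). **Theorem.** For every ordinal $\alpha$, $H_\alpha$ and $\mathsf{P_f}(H_\alpha)$ are wqos, and $$\mathbf{o}(H_\alpha)=\mathbf{w}(H_\alpha)=\alpha,\qquad \mathbf{o}(\mathsf{P_f}(H_\alpha))=2^\alpha .$$ If $\alpha$ is infinite, then moreover $\mathbf{w}(\mathsf{P_f}(H_\alpha))=2^\alpha$; if $\alpha=k$ is finite, then $\mathbf{w}(\mathsf{P_f}(H_k))=\mathbf{w}(\mathsf{P_f}(\Gamma_k))$. That is, $\mathsf{P_f}(H_\alpha)$ attains,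 for every $\alpha$, the general upper bound $\mathbf{o}(\mathsf{P_f}(A))\le 2^{\mathbf{o}(A)}$ and the general lower bound on the width of $\mathsf{P_f}(A)$, which is $2^{\mathbf{w}(A)}$ for infinite $\mathbf{w}(A)$ and $\mathbf{w}(\mathsf{P_f}(\Gamma_k))$ for $\mathbf{w}(A)=k<\omega$. -/

import Mathlib

open scoped Ordinal

/-! Quasi-orders are Mathlib's bundled preorders `Preord`. They are well-quasi-orders when
`WellQuasiOrderedLE` holds: every infinite sequence contains an increasing pair. -/

universe u v

namespace PfTight

/-! ### Ordinal invariants -/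

/-- The tree of finite sequences over `A` in which every earlier entry `x` and every later
entry `y` satisfy `R x y`. -/
abbrev SeqTree {A : Type u} (R : A → A → Prop) : Type u :=
  {s : List A // s.Pairwise R}

/-- The strict inverse prefix order on a tree of sequences: `t` lies strictly below `s` when `s`
is a proper prefix of `t`. -/
def SeqTree.Below {A : Type u} {R : A → A → Prop} (t s : SeqTree R) : Prop :=
  s.1 <+: t.1 ∧ s.1 ≠ t.1

open Classical in
/-- The ordinal rank of the root (the empty sequence) of a well-founded tree of sequences, where
the rank of a node is the supremum of the `r + 1` for `r` the rank of a node strictly below it.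
(Junk value `0` when the tree is not well-founded; this never happens for the trees of bad
sequences and of antichain sequences of a well-quasi-order.) -/
noncomputable def treeRank {A : Type u} (R : A → A → Prop) : Ordinal.{u} :=
  if h : WellFounded (SeqTree.Below (R := R)) then (h.apply ⟨[], List.Pairwise.nil⟩).rank else 0

/-- The maximal order type: the rank of the tree of bad sequences, that is, of the sequences
without an increasing pair `x ≤ y` with `x` before `y`. -/
noncomputable def mot (A : Preord.{u}) : Ordinal.{u} :=
  treeRank fun x y : A => ¬ x ≤ y

/-- The width: the rank of the tree of antichain sequences, that is, of the sequences of
pairwise incomparable elements. -/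
noncomputable def width (A : Preord.{u}) : Ordinal.{u} :=
  treeRank fun x y : A => ¬ x ≤ y ∧ ¬ y ≤ x

/-! ### Operations on quasi-orders -/

/-- The quasi-order on `X` given by a reflexive and transitive relation. -/
def ofRel {X : Type u} (r : X → X → Prop) (hr : ∀ x, r x x)
    (ht : ∀ x y z, r x y → r y z → r x z) : Preord.{u} where
  carrier := X
  str :=
    { le := r
      lt := fun x y => r x y ∧ ¬ r y x
      le_refl := hr
      le_trans := ht
      lt_iff_le_not_ge := fun _ _ => Iff.rfl }

/-- The antichain `Γ_k` with `k` elements. -/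
def antichain (k : ℕ) : Preord.{u} :=
  ofRel (X := ULift.{u} (Fin k)) (fun x y => x = y) (fun _ => rfl) (fun _ _ _ h h' => h.trans h')

/-- The disjoint sum `A ⊔ B`: elements of different summands are incomparable. -/
def disjSum (A B : Preord.{u}) : Preord.{u} := .of (A ⊕ B)

/-- The lexicographic sum `∑ i, A i` along a linear order: `(i, a) ≤ (j, b)` iff `i < j`, or
`i = j` and `a ≤ b`. -/
def lexSum {ι : Type v} [LinearOrder ι] (A : ι → Preord.{u}) : Preord.{max v u} :=
  .of (Σₗ i, A i)

/-- The lexicographic product `A · B`, in which the second component has priority. -/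
def lexProd (A B : Preord.{u}) : Preord.{u} :=
  ofRel (X := A × B) (fun p q => p.2 ≤ q.2 ∧ (p.2 ≤ q.2 ∧ q.2 ≤ p.2 → p.1 ≤ q.1))
    (fun _ => ⟨le_rfl, fun _ => le_rfl⟩)
    (fun _ _ _ h h' => ⟨h.1.trans h'.1, fun e =>
      (h.2 ⟨h.1, h'.1.trans e.2⟩).trans (h'.2 ⟨h'.1, e.2.trans h.1⟩)⟩)

/-- `A₁ ⊔ ⋯ ⊔ Aₙ`; the empty sum is the empty order. -/
def disjSumList : List Preord.{u} → Preord.{u}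
  | [] => antichain 0
  | [A] => A
  | A :: B :: l => disjSum A (disjSumList (B :: l))

/-- `A₁ · A₂ ⋯ Aₙ` (lexicographic product); the empty product is the one-point order. -/
def lexProdList : List Preord.{u} → Preord.{u}
  | [] => antichain 1
  | [A] => A
  | A :: B :: l => lexProd A (lexProdList (B :: l))

/-- The finitary powerset: finite subsets of `A` with the Hoare (domination) quasi-order,
`S ≤ T` iff every element of `S` is below some element of `T`. -/
def finPowerset (A : Preord.{u}) : Preord.{u} :=
  ofRel (X := Finset A) (fun S T => ∀ a ∈ S, ∃ b ∈ T, a ≤ b)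
    (fun _ a ha => ⟨a, ha, le_rfl⟩)
    (fun _ _ _ h h' a ha =>
      let ⟨b, hb, hab⟩ := h a ha
      let ⟨c, hc, hbc⟩ := h' b hb
      ⟨c, hc, hab.trans hbc⟩)

/-! ### The family `H_α` -/

/-- The exponents `α₁ ≥ ⋯ ≥ αₙ`, repeated according to their coefficients, of the Cantor normal
form `o = ω ^ α₁ + ⋯ + ω ^ αₙ`. -/
noncomputable def cnfExponents (o : Ordinal.{u}) : List Ordinal.{u} :=
  (Ordinal.CNF ω o).flatMap fun p => List.replicate p.2.card.toNat p.1

theorem sum_cnfExponents (o : Ordinal.{u}) :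
    ((cnfExponents o).map fun e => ω ^ e).sum = o := by
  have key : ∀ l : List (Ordinal.{u} × Ordinal.{u}), (∀ p ∈ l, p.2 < ω) →
      ((l.flatMap fun p => List.replicate p.2.card.toNat p.1).map fun e => (ω ^ e : Ordinal)).sum
        = l.foldr (fun p r => ω ^ p.1 * p.2 + r) 0 := by
    intro l
    induction l with
    | nil => simp
    | cons p l ih =>
      intro h
      obtain ⟨n, hn⟩ := Ordinal.lt_omega0.1 (h p (by simp))
      simp only [List.flatMap_cons, List.map_append, List.sum_append, List.foldr_cons]
      rw [ih fun q hq => h q (by simp [hq])]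
      simp [hn]
  rw [cnfExponents, key _ fun p hp => Ordinal.CNF.snd_lt Ordinal.one_lt_omega0 hp,
    Ordinal.CNF.foldr]

theorem sorted_cnfExponents (o : Ordinal.{u}) : (cnfExponents o).Pairwise (· ≥ ·) := by
  rw [cnfExponents, List.pairwise_flatMap]
  refine ⟨fun p _ => by simp, ?_⟩
  have h := Ordinal.CNF.sortedGT ω o
  rw [List.sortedGT_iff_pairwise, List.pairwise_map] at h
  refine h.imp fun hpq x hx y hy => ?_
  rw [List.eq_of_mem_replicate hx, List.eq_of_mem_replicate hy]
  exact hpq.le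

theorem opow_lt_of_mem_cnfExponents {a o : Ordinal.{u}} (ha : a ∈ cnfExponents o)
    (ho : ¬ ∃ e : Ordinal.{u}, o = ω ^ e) : ω ^ a < o := by
  obtain ⟨p, hp, hap⟩ := List.mem_flatMap.1 ha
  obtain rfl := List.eq_of_mem_replicate hap
  have h0 : o ≠ 0 := by rintro rfl; simp at hp
  have h : ω ^ p.1 ≤ o :=
    (Ordinal.opow_le_opow_right Ordinal.omega0_pos (Ordinal.CNF.fst_le_log hp)).trans
      (Ordinal.opow_log_le_self ω h0)
  exact h.lt_of_ne fun e => ho ⟨_, e.symm⟩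

open Classical in
/-- `HOpow γ` is `H_{ω ^ γ}`:
* `H_{ω ^ 0} = Γ_1`,
* `H_{ω ^ 1} = ∑_{n < ω} Γ_n`,
* `H_{ω ^ γ} = ∑_{β < γ} H_{ω ^ β}` when `γ = ω ^ a` with `a > 0`,
* `H_{ω ^ γ} = H_{ω ^ ω ^ α₁} · H_{ω ^ ω ^ α₂} ⋯ H_{ω ^ ω ^ αₙ}` (lexicographic product)
  when `γ = ω ^ α₁ + ⋯ + ω ^ αₙ` in Cantor normal form with `n > 1`. -/
noncomputable def HOpow (γ : Ordinal.{u}) : Preord.{u} :=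
  if γ = 0 then antichain 1
  else if γ = 1 then lexSum fun n : ℕ => antichain n
  else if ∃ a : Ordinal.{u}, γ = ω ^ a then lexSum fun b : γ.ToType => HOpow b.toOrd.1
  else lexProdList ((cnfExponents γ).attach.map fun a => HOpow (ω ^ a.1))
termination_by γ
decreasing_by
  · exact b.toOrd.2
  · rename_i h
    exact opow_lt_of_mem_cnfExponents a.2 h

/-- `H_α = H_{ω ^ α₁} ⊔ ⋯ ⊔ H_{ω ^ αₙ}` for `α = ω ^ α₁ + ⋯ + ω ^ αₙ` in Cantor normal form. -/
noncomputable def H (α : Ordinal.{u}) : Preord.{u} :=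
  disjSumList ((cnfExponents α).map HOpow)

end PfTight

/-!
The maximal order type and the width are ranks of trees of sequences. Both are handled through the
sets of elements that may still be appended to a sequence: `RankLE R S o` and `RankGE R S o` bound
the rank of the tree of `R`-sequences over a set `S` from above and from below, by recursion on the
ordinal `o`. An upper bound by any ordinal already shows that the tree is well-founded, so the
well-quasi-order claims come for free. Since antichain sequences are bad sequences, all equalities
follow from upper bounds on bad sequences and lower bounds on antichain sequences.

For `H α` itself, the ranks `ω ^ γ` of the orders `HOpow γ` are computed along their definition
(`rankLE_HOpow`, `rankGE_HOpow`), and the disjoint sum adds them up: in Cantor normal form the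
natural sum, which bounds bad sequences of a disjoint sum, is the ordinary sum
(`natSumLE_opow_add`).

The upper bound `2 ^ o` for the finite powerset of an order of maximal order type `o` holds for
every well-quasi-order (`rankLE_finset`).

For the lower bound, the powerset of `A ⊔ B` is the product of the two powersets. If the powerset of
`A` has width `κ`, and keeps that width when the subsets dominated by any given finite set are
removed (`PowWidthRobust`), then bad sequences in the powerset of `B` can be interleaved with
antichains in the powerset of `A`, and the product has width at least `κ` times the maximal order
type of the powerset of `B` (`PowWidthRobust.disjSum`). Every `HOpow γ` with `γ ≠ 0` is robust with
`κ = 2 ^ ω ^ γ`: at a lexicographic sum because a finite set meets only finitely many summands, and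
at a lexicographic product because right multiplication by `HOpow δ` raises `κ` to the power
`ω ^ δ` (`powWidthRobust_HOpow`). An infinite `α` has a nonzero leading exponent, so the first
summand of `H α` is robust and the widths multiply up to `2 ^ α`. For `α = k` finite, `H α` is
isomorphic to the antichain with `k` elements.
-/

universe w

namespace PfTight

open Order Set

/-! ### Ranks of residual sets -/

/-- `RankLE R S o`: the tree of sequences over `S` whose entries are related by `R` from left to
right has rank at most `o`. The recursion passes from `S` to the set of elements still available
after the first entry. -/
def RankLE {A : Type u} (R : A → A → Prop) (S : Set A) (o : Ordinal.{v}) : Prop :=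
  ∀ x ∈ S, ∃ o', ∃ _ : o' < o, RankLE R {y | y ∈ S ∧ R x y} o'
termination_by o

/-- `RankGE R S o`: the rank described by `RankLE` is at least `o` (or does not exist). -/
def RankGE {A : Type u} (R : A → A → Prop) (S : Set A) (o : Ordinal.{v}) : Prop :=
  ∀ o' < o, ¬ RankLE R S o'

section Rank

variable {A : Type u} {B : Type w} {R : A → A → Prop} {R' : B → B → Prop} {S T : Set A}
  {a b o o' : Ordinal.{v}}

theorem rankLE_iff : RankLE R S o ↔ ∀ x ∈ S, ∃ o' < o, RankLE R {y | y ∈ S ∧ R x y} o' := by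
  rw [RankLE]; simp only [exists_prop]

theorem rankGE_iff : RankGE R S o ↔ ∀ o' < o, ∃ x ∈ S, RankGE R {y | y ∈ S ∧ R x y} o' := by
  unfold RankGE
  refine forall₂_congr fun o' _ => ?_
  rw [rankLE_iff]
  push Not
  rfl

/-- Upper bounds pull back along maps that preserve the relation. -/
theorem RankLE.comap {T : Set B} (h : RankLE R' T o) (f : A → B) (hf : MapsTo f S T)
    (hR : ∀ x ∈ S, ∀ y ∈ S, R x y → R' (f x) (f y)) (ho : o ≤ o') : RankLE R S o' := by
  induction o using WellFoundedLT.induction generalizing S T o' with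
  | ind o ih =>
    rw [rankLE_iff] at h ⊢
    intro x hx
    obtain ⟨p, hp, hr⟩ := h (f x) (hf hx)
    exact ⟨p, hp.trans_le ho, ih p hp hr (fun y hy => ⟨hf hy.1, hR x hx y hy.1 hy.2⟩)
      (fun y hy z hz => hR y hy.1 z hz.1) le_rfl⟩

theorem RankLE.mono (h : RankLE R T o) (hS : S ⊆ T) (ho : o ≤ o') : RankLE R S o' :=
  h.comap id hS (fun _ _ _ _ h => h) ho

theorem RankLE.image (h : RankLE R S o) (f : A → B) (hR : ∀ x y, R' (f x) (f y) → R x y) :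
    RankLE R' (f '' S) o := by
  induction o using WellFoundedLT.induction generalizing S with
  | ind o ih =>
    rw [rankLE_iff] at h ⊢
    rintro _ ⟨x, hx, rfl⟩
    obtain ⟨p, hp, hr⟩ := h x hx
    refine ⟨p, hp, (ih p hp hr).mono ?_ le_rfl⟩
    rintro _ ⟨⟨y, hy, rfl⟩, hxy⟩
    exact ⟨y, ⟨hy, hR x y hxy⟩, rfl⟩

/-- Lower bounds push forward along maps that preserve the relation. -/
theorem RankGE.map {T : Set B} (h : RankGE R S o) (f : A → B) (hf : MapsTo f S T)
    (hR : ∀ x ∈ S, ∀ y ∈ S, R x y → R' (f x) (f y)) (ho : o' ≤ o) : RankGE R' T o' :=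
  fun p hp hle => h p (hp.trans_le ho) (hle.comap f hf hR le_rfl)

theorem RankGE.mono (h : RankGE R S o) (hS : S ⊆ T) (ho : o' ≤ o) : RankGE R T o' :=
  h.map id hS (fun _ _ _ _ h => h) ho

theorem RankGE.of_forall_lt (h : ∀ p < o, ∃ q > p, RankGE R S q) : RankGE R S o := fun p hp =>
  let ⟨_, hq, hr⟩ := h p hp
  hr p hq

theorem RankGE.zero : RankGE R S (0 : Ordinal.{v}) := fun _ h => absurd h not_lt_zero

theorem RankGE.one (h : S.Nonempty) : RankGE R S (1 : Ordinal.{v}) := by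
  obtain ⟨x, hx⟩ := h
  rw [rankGE_iff]
  intro o' ho
  obtain rfl := Order.lt_one_iff.1 ho
  exact ⟨x, hx, RankGE.zero⟩

/-- A sequence over `X` may be followed by one over `Y`: if any finitely many elements of `X` leave
a part of `Y` of rank at least `b`, the ranks add up, the later part `b` being the left summand. -/
theorem RankGE.add {X Y : Set A} (hX : RankGE R X a)
    (hY : ∀ G : Finset A, (↑G ⊆ X) → RankGE R {y | y ∈ Y ∧ ∀ g ∈ G, R g y} b) :
    RankGE R (X ∪ Y) (b + a) := by
  classical
  induction a using WellFoundedLT.induction generalizing X Y with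
  | ind a ih =>
    have h0 : RankGE R (X ∪ Y) b := (hY ∅ (by simp)).mono (fun y hy => Or.inr hy.1) le_rfl
    refine RankGE.of_forall_lt fun p hp => ?_
    rcases lt_or_ge p b with hpb | hpb
    · exact ⟨b, hpb, h0⟩
    · have hpa : p - b < a := by
        rw [Ordinal.sub_lt_of_le hpb]; exact hp
      obtain ⟨x, hx, hr⟩ := rankGE_iff.1 hX _ hpa
      have := ih _ hpa hr (Y := {y | y ∈ Y ∧ R x y}) (fun G hG =>
        (hY (insert x G) (by
          rw [Finset.coe_insert]
          exact insert_subset hx fun g hg => (hG hg).1)).mono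
          (fun y hy => ⟨⟨hy.1, hy.2 x (by simp)⟩, fun g hg => hy.2 g (by simp [hg])⟩) le_rfl)
      refine ⟨p + 1, by simp, ?_⟩
      rw [rankGE_iff]
      intro q hq
      refine ⟨x, Or.inl hx, this.mono ?_ ?_⟩
      · rintro y (hy | hy)
        · exact ⟨Or.inl hy.1, hy.2⟩
        · exact ⟨Or.inr hy.1, hy.2⟩
      · rw [Ordinal.add_sub_cancel_of_le hpb]; exact Order.lt_add_one_iff.1 hq

/-- The least upper bound for the rank is also a lower bound. -/
theorem RankLE.exists_eq (h : RankLE R S o) : ∃ p : Ordinal.{v}, RankLE R S p ∧ RankGE R S p :=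
  ⟨sInf {p : Ordinal.{v} | RankLE R S p}, csInf_mem (s := {p : Ordinal.{v} | RankLE R S p}) ⟨o, h⟩,
    fun _ hq => notMem_of_lt_csInf' hq⟩

end Rank

section Tree

variable {A : Type u} {R : A → A → Prop} {o : Ordinal.{u}}

/-- The elements that may follow a sequence. -/
def residual (s : SeqTree R) : Set A := {y | ∀ x ∈ s.1, R x y}

/-- The extension of a sequence by an admissible element. -/
def SeqTree.snoc (s : SeqTree R) (x : A) (hx : x ∈ residual s) : SeqTree R :=
  ⟨s.1 ++ [x], by
    rw [List.pairwise_append]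
    exact ⟨s.2, List.pairwise_singleton _ _, fun a ha b hb => by
      rw [List.mem_singleton.1 hb]; exact hx a ha⟩⟩

theorem SeqTree.snoc_below (s : SeqTree R) (x : A) (hx : x ∈ residual s) :
    SeqTree.Below (s.snoc x hx) s := ⟨⟨[x], rfl⟩, by simp [SeqTree.snoc]⟩

theorem residual_snoc (s : SeqTree R) (x : A) (hx : x ∈ residual s) :
    residual (s.snoc x hx) = {y | y ∈ residual s ∧ R x y} := by
  ext y
  simp [residual, SeqTree.snoc, or_imp, forall_and]

theorem SeqTree.Below.exists_snoc {s t : SeqTree R} (h : SeqTree.Below t s) :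
    ∃ x, ∃ hx : x ∈ residual s, t = s.snoc x hx ∨ SeqTree.Below t (s.snoc x hx) := by
  obtain ⟨⟨r, hr⟩, hne⟩ := h
  match r, hr with
  | [], hr => exact absurd (by simpa using hr) hne
  | x :: r, hr =>
    have ht := t.2
    rw [← hr, List.pairwise_append] at ht
    refine ⟨x, fun a ha => ht.2.2 a ha x (by simp), ?_⟩
    match r, hr with
    | [], hr => exact Or.inl (Subtype.ext hr.symm)
    | z :: r, hr =>
      refine Or.inr ⟨⟨z :: r, by simpa [SeqTree.snoc] using hr⟩, fun h => ?_⟩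
      have := congrArg List.length (h.trans hr.symm)
      simp [SeqTree.snoc] at this

theorem exists_rank_le_of_rankLE {s : SeqTree R} (h : RankLE R (residual s) o) :
    ∃ hs : Acc (SeqTree.Below (R := R)) s, hs.rank ≤ o := by
  induction o using WellFoundedLT.induction generalizing s with
  | ind o ih =>
    rw [rankLE_iff] at h
    have key : ∀ t, SeqTree.Below t s → ∃ ht : Acc (SeqTree.Below (R := R)) t, ht.rank < o := by
      intro t ht
      obtain ⟨x, hx, hxt⟩ := ht.exists_snoc
      obtain ⟨p, hp, hr⟩ := h x hx
      rw [← residual_snoc s x hx] at hr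
      obtain ⟨hacc, hle⟩ := ih p hp hr
      rcases hxt with rfl | hb
      · exact ⟨hacc, hle.trans_lt hp⟩
      · exact ⟨hacc.inv hb, ((Acc.rank_lt_of_rel hacc hb).trans_le hle).trans hp⟩
    refine ⟨Acc.intro s fun t ht => (key t ht).1, ?_⟩
    rw [Acc.rank_eq]
    exact Ordinal.iSup_le fun t => Order.succ_le_of_lt (key t.1 t.2).2

theorem le_rank_of_rankGE {s : SeqTree R} (h : RankGE R (residual s) o)
    (hs : Acc (SeqTree.Below (R := R)) s) : o ≤ hs.rank := by
  induction o using WellFoundedLT.induction generalizing s with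
  | ind o ih =>
    refine le_of_forall_lt fun p hp => ?_
    obtain ⟨x, hx, hr⟩ := rankGE_iff.1 h p hp
    rw [← residual_snoc s x hx] at hr
    exact (ih p hp hr (hs.inv (s.snoc_below x hx))).trans_lt
      (Acc.rank_lt_of_rel hs (s.snoc_below x hx))

theorem wellFounded_below (h : RankLE R univ o) : WellFounded (SeqTree.Below (R := R)) := by
  refine ⟨fun s => ?_⟩
  exact (exists_rank_le_of_rankLE (h.mono (subset_univ _) le_rfl)).1

theorem treeRank_eq (h : RankLE R univ o) (h' : RankGE R univ o) : treeRank R = o := by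
  rw [treeRank, dif_pos (wellFounded_below h)]
  have e : residual (R := R) ⟨[], List.Pairwise.nil⟩ = univ := by simp [residual]
  refine le_antisymm ?_ (le_rank_of_rankGE (by rwa [e]) _)
  rw [← e] at h
  exact (exists_rank_le_of_rankLE h).2

/-- Two relations with maps in both directions that preserve them have the same rank. -/
theorem treeRank_congr {B : Type u} {R' : B → B → Prop} (h : RankLE R univ o) (f : A → B)
    (hf : ∀ x y, R x y → R' (f x) (f y)) (g : B → A) (hg : ∀ x y, R' x y → R (g x) (g y)) :
    treeRank R = treeRank R' := by
  obtain ⟨p, hle, hge⟩ := h.exists_eq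
  rw [treeRank_eq hle hge, treeRank_eq
    (hle.comap g (mapsTo_univ _ _) (fun x _ y _ => hg x y) le_rfl)
    (hge.map f (mapsTo_univ _ _) (fun x _ y _ => hf x y) le_rfl)]

theorem wellQuasiOrderedLE_of_rankLE {A : Type u} [Preorder A]
    (h : RankLE (fun x y : A => ¬ x ≤ y) univ o) : WellQuasiOrderedLE A := by
  refine ⟨fun f => ?_⟩
  by_contra! hf
  have key : ∀ (o : Ordinal.{u}) (n : ℕ) (S : Set A), (∀ m ≥ n, f m ∈ S) →
      ¬ RankLE (fun x y : A => ¬ x ≤ y) S o := by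
    intro o
    induction o using WellFoundedLT.induction with
    | ind o ih =>
      intro n S hS hle
      obtain ⟨p, hp, hr⟩ := rankLE_iff.1 hle (f n) (hS n le_rfl)
      refine ih p hp (n + 1) _ ?_ hr
      exact fun m hm => ⟨hS m (by omega), hf n m (by omega)⟩
  exact key o 0 univ (fun _ _ => mem_univ _) h

end Tree

/-! ### Natural sums and unions -/

/-- `NatSumLE a b c`: the natural (Hessenberg) sum of `a` and `b` is at most `c`. -/
def NatSumLE (a b c : Ordinal.{v}) : Prop :=
  (∀ a' < a, ∃ c', ∃ _ : c' < c, NatSumLE a' b c') ∧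
    ∀ b' < b, ∃ c', ∃ _ : c' < c, NatSumLE a b' c'
termination_by c

theorem natSumLE_iff {a b c : Ordinal.{v}} :
    NatSumLE a b c ↔ (∀ a' < a, ∃ c' < c, NatSumLE a' b c') ∧
      ∀ b' < b, ∃ c' < c, NatSumLE a b' c' := by
  rw [NatSumLE]; simp only [exists_prop]

theorem natSumLE_zero_left (b : Ordinal.{v}) : NatSumLE 0 b b := by
  induction b using WellFoundedLT.induction with
  | ind b ih =>
    rw [natSumLE_iff]
    exact ⟨fun a ha => absurd ha not_lt_zero, fun b' hb => ⟨b', hb, ih b' hb⟩⟩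

theorem RankLE.union {A : Type u} {R : A → A → Prop} {X Y : Set A} {a b c : Ordinal.{v}}
    (hX : RankLE R X a) (hY : RankLE R Y b) (h : NatSumLE a b c) : RankLE R (X ∪ Y) c := by
  induction c using WellFoundedLT.induction generalizing X Y a b with
  | ind c ih =>
    rw [rankLE_iff]
    rw [natSumLE_iff] at h
    rintro x (hx | hx)
    · obtain ⟨a', ha, hr⟩ := rankLE_iff.1 hX x hx
      obtain ⟨c', hc, hn⟩ := h.1 a' ha
      refine ⟨c', hc, (ih c' hc hr hY hn).mono ?_ le_rfl⟩
      rintro y ⟨hy | hy, hxy⟩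
      exacts [Or.inl ⟨hy, hxy⟩, Or.inr hy]
    · obtain ⟨b', hb, hr⟩ := rankLE_iff.1 hY x hx
      obtain ⟨c', hc, hn⟩ := h.2 b' hb
      refine ⟨c', hc, (ih c' hc hX hr hn).mono ?_ le_rfl⟩
      rintro y ⟨hy | hy, hxy⟩
      exacts [Or.inl hy, Or.inr ⟨hy, hxy⟩]

/-- An ordinal below `ω ^ c * m + e` lowers either the remainder `e` or the coefficient `m`. -/
theorem lt_opow_mul_add {c a e : Ordinal.{v}} {m : ℕ} (h : a < ω ^ c * m + e) :
    (∃ e' < e, a = ω ^ c * m + e') ∨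
      ∃ m' < m, ∃ e' < ω ^ c, a = ω ^ c * (m' : ℕ) + e' := by
  rcases le_or_gt (ω ^ c * m) a with hle | hlt
  · refine Or.inl ⟨a - ω ^ c * m, ?_, (Ordinal.add_sub_cancel_of_le hle).symm⟩
    rwa [Ordinal.sub_lt_of_le hle]
  · have hpos : (ω ^ c : Ordinal.{v}) ≠ 0 := (Ordinal.opow_pos c Ordinal.omega0_pos).ne'
    have hdiv : a / ω ^ c < m := (Ordinal.lt_mul_iff_div_lt hpos).1 hlt
    obtain ⟨m', hm'⟩ := Ordinal.lt_omega0.1 (hdiv.trans (Ordinal.natCast_lt_omega0 m))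
    refine Or.inr ⟨m', by rw [hm'] at hdiv; exact_mod_cast hdiv, a % ω ^ c,
      Ordinal.mod_lt a hpos, ?_⟩
    rw [← hm', Ordinal.div_add_mod]

theorem opow_mul_add_lt_of_lt {c g d : Ordinal.{v}} {m n : ℕ} (hmn : m < n) (hg : g < ω ^ c) :
    ω ^ c * (m : Ordinal) + g < ω ^ c * (n : Ordinal) + d :=
  calc ω ^ c * (m : Ordinal) + g < ω ^ c * m + ω ^ c := by gcongr
    _ = ω ^ c * ((m + 1 : ℕ) : Ordinal) := by push_cast; rw [mul_add_one]
    _ ≤ ω ^ c * n := by gcongr; omega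
    _ ≤ _ := le_self_add

/-- If `ω ^ c` is closed under natural sums, then natural sums of multiples of `ω ^ c` with
remainders are computed componentwise. -/
theorem NatSumLE.opow_mul_add {c : Ordinal.{v}}
    (H : ∀ a < ω ^ c, ∀ b < ω ^ c, ∃ d < ω ^ c, NatSumLE a b d)
    {e f g : Ordinal.{v}} (h : NatSumLE e f g) (he : e < ω ^ c) (hf : f < ω ^ c) (hg : g < ω ^ c)
    (m k : ℕ) :
    NatSumLE (ω ^ c * m + e) (ω ^ c * k + f) (ω ^ c * (m + k : ℕ) + g) := by
  obtain ⟨N, hN⟩ : ∃ N, m + k = N := ⟨_, rfl⟩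
  induction N using Nat.strong_induction_on generalizing m k e f g with
  | _ N ihN =>
  induction g using WellFoundedLT.induction generalizing e f with
  | ind g ihg =>
    have h2 := natSumLE_iff.1 h
    rw [natSumLE_iff]
    constructor
    · intro a ha
      rcases lt_opow_mul_add ha with ⟨e', he', rfl⟩ | ⟨m', hm', e', he', rfl⟩
      · obtain ⟨g', hg', hn⟩ := h2.1 e' he'
        exact ⟨_, by gcongr, ihg g' hg' hn (he'.trans he) hf (hg'.trans hg)⟩
      · obtain ⟨d, hd, hn⟩ := H e' he' f hf
        exact ⟨_, opow_mul_add_lt_of_lt (by omega) hd,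
          ihN (m' + k) (by omega) hn he' hf hd m' k rfl⟩
    · intro a ha
      rcases lt_opow_mul_add ha with ⟨e', he', rfl⟩ | ⟨m', hm', e', he', rfl⟩
      · obtain ⟨g', hg', hn⟩ := h2.2 e' he'
        exact ⟨_, by gcongr, ihg g' hg' hn he (he'.trans hf) (hg'.trans hg)⟩
      · obtain ⟨d, hd, hn⟩ := H e he e' he'
        exact ⟨_, opow_mul_add_lt_of_lt (by omega) hd,
          ihN (m + m') (by omega) hn he he' hd m m' rfl⟩

/-- Powers of `ω` are closed under natural sums. -/
theorem exists_natSumLE_lt_opow (c : Ordinal.{v}) :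
    ∀ a < ω ^ c, ∀ b < ω ^ c, ∃ d < ω ^ c, NatSumLE a b d := by
  induction c using Ordinal.limitRecOn with
  | zero =>
    intro a ha b hb
    rw [Ordinal.opow_zero, Order.lt_one_iff] at ha hb
    subst ha hb
    exact ⟨0, by simp, natSumLE_zero_left 0⟩
  | add_one c ih =>
    intro a ha b hb
    have aux : ∀ x < (ω ^ (c + 1) : Ordinal.{v}), ∃ m : ℕ, ∃ e < ω ^ c, x = ω ^ c * m + e := by
      intro x hx
      obtain ⟨n, hn⟩ := Ordinal.lt_omega0_opow_succ.1 hx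
      rcases lt_opow_mul_add (m := n) (e := 0) (by simpa using hn) with
        ⟨e, he, -⟩ | ⟨m, -, e, he, rfl⟩
      · exact absurd he not_lt_zero
      · exact ⟨m, e, he, rfl⟩
    obtain ⟨m, e, he, rfl⟩ := aux a ha
    obtain ⟨k, f, hf, rfl⟩ := aux b hb
    obtain ⟨g, hg, hn⟩ := ih e he f hf
    refine ⟨_, ?_, hn.opow_mul_add ih he hf hg m k⟩
    exact Ordinal.opow_mul_add_lt_opow (Ordinal.natCast_lt_omega0 _) hg (lt_add_one c)
  | limit c hc ih =>
    intro a ha b hb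
    obtain ⟨p, hp, hap⟩ := (Ordinal.lt_opow_of_isSuccLimit Ordinal.omega0_ne_zero hc).1 ha
    obtain ⟨q, hq, hbq⟩ := (Ordinal.lt_opow_of_isSuccLimit Ordinal.omega0_ne_zero hc).1 hb
    have hle := fun x (h : x ≤ max p q) => Ordinal.opow_le_opow_right Ordinal.omega0_pos h
    obtain ⟨d, hd, hn⟩ := ih (max p q) (max_lt hp hq) a (hap.trans_le (hle p (le_max_left _ _)))
      b (hbq.trans_le (hle q (le_max_right _ _)))
    exact ⟨d, hd.trans_le (Ordinal.opow_le_opow_right Ordinal.omega0_pos (max_lt hp hq).le), hn⟩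

theorem natSumLE_opow_mul_nat (c : Ordinal.{v}) (m k : ℕ) :
    NatSumLE (ω ^ c * m) (ω ^ c * k) (ω ^ c * (m + k : ℕ)) := by
  have h0 : (0 : Ordinal.{v}) < ω ^ c := Ordinal.opow_pos c Ordinal.omega0_pos
  simpa using (natSumLE_zero_left 0).opow_mul_add (exists_natSumLE_lt_opow c) h0 h0 h0 m k

/-- When no exponent in the Cantor normal form of `b` exceeds `c`, the natural sum of `ω ^ c` and
`b` is the ordinary one. -/
theorem natSumLE_opow_add {c b : Ordinal.{v}} (hb : b < ω ^ (c + 1)) :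
    NatSumLE (ω ^ c) b (ω ^ c + b) := by
  have h0 : (0 : Ordinal.{v}) < ω ^ c := Ordinal.opow_pos c Ordinal.omega0_pos
  obtain ⟨n, hn⟩ := Ordinal.lt_omega0_opow_succ.1 hb
  rcases lt_opow_mul_add (m := n) (e := 0) (by simpa using hn) with
    ⟨e, he, -⟩ | ⟨m, -, e, he, rfl⟩
  · exact absurd he not_lt_zero
  · have := (natSumLE_zero_left e).opow_mul_add (exists_natSumLE_lt_opow c) h0 he he 1 m
    rw [← add_assoc]
    rw [Nat.cast_add, Nat.cast_one, mul_add, mul_one, add_zero] at this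
    exact this

theorem RankLE.exists_union_lt_opow {A : Type u} {R : A → A → Prop} {X Y : Set A}
    {a b c : Ordinal.{v}} (hX : RankLE R X a) (hY : RankLE R Y b) (ha : a < ω ^ c)
    (hb : b < ω ^ c) : ∃ d < ω ^ c, RankLE R (X ∪ Y) d :=
  let ⟨d, hd, hn⟩ := exists_natSumLE_lt_opow c a ha b hb
  ⟨d, hd, hX.union hY hn⟩

theorem exists_rankLE_biUnion_lt_opow {A I : Type u} {R : A → A → Prop} (s : Finset I)
    (X : I → Set A) (c : Ordinal.{v}) (h : ∀ i ∈ s, ∃ d < ω ^ c, RankLE R (X i) d) :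
    ∃ d < ω ^ c, RankLE R (⋃ i ∈ s, X i) d := by
  classical
  induction s using Finset.induction_on with
  | empty =>
    refine ⟨0, Ordinal.opow_pos c Ordinal.omega0_pos, rankLE_iff.2 fun x hx => ?_⟩
    simp at hx
  | insert i s _ ih =>
    obtain ⟨d, hd, hr⟩ := ih fun j hj => h j (Finset.mem_insert_of_mem hj)
    obtain ⟨e, he, hi⟩ := h i (Finset.mem_insert_self i s)
    rw [Finset.set_biUnion_insert]
    exact hi.exists_union_lt_opow hr he hd

/-! ### The finitary powerset: upper bound -/

/-- The relation of bad sequences. -/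
abbrev Bad {A : Type u} [LE A] (x y : A) : Prop := ¬ x ≤ y

/-- The relation of antichain sequences. -/
abbrev Incomp {A : Type u} [LE A] (x y : A) : Prop := ¬ x ≤ y ∧ ¬ y ≤ x

/-- The domination quasi-order on finite subsets. -/
abbrev Dom {A : Type u} [LE A] (S T : Finset A) : Prop := ∀ a ∈ S, ∃ b ∈ T, a ≤ b

/-- The relation of bad sequences of finite sets. -/
abbrev PBad {A : Type u} [LE A] (S T : Finset A) : Prop := ¬ Dom S T

/-- The relation of antichain sequences of finite sets. -/
abbrev PIncomp {A : Type u} [LE A] (S T : Finset A) : Prop := ¬ Dom S T ∧ ¬ Dom T S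

theorem two_opow_omega0_mul (q : Ordinal.{v}) : (2 : Ordinal.{v}) ^ (ω * q) = ω ^ q := by
  rw [Ordinal.opow_mul]
  congr 1
  exact_mod_cast Ordinal.natCast_opow_omega0 (n := 2) (by norm_num)

theorem two_opow_omega0_mul_add (q : Ordinal.{v}) (n : ℕ) :
    (2 : Ordinal.{v}) ^ (ω * q + n) = ω ^ q * (2 ^ n : ℕ) := by
  rw [Ordinal.opow_add, two_opow_omega0_mul, Ordinal.opow_natCast]
  norm_cast

/-- The finite subsets of a set of rank at most `o` have rank at most `2 ^ o`. For `o` divisible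
by `ω`, the sets that do not dominate a given finite set are covered by finitely many powersets of
smaller rank. For `o = p + 1`, all but one class `U` of maximal elements has rank at most
`p`, and up to equivalence a finite set is given by its part outside `U` and by whether it
meets `U`. -/
theorem rankLE_finset {A : Type u} [Preorder A] {S : Set A} {o : Ordinal.{v}}
    (h : RankLE Bad S o) : RankLE PBad {T : Finset A | ↑T ⊆ S} (2 ^ o) := by
  classical
  induction o using WellFoundedLT.induction generalizing S with
  | ind o ih =>
  have two_mono : ∀ {p q : Ordinal.{v}}, p ≤ q → (2 : Ordinal.{v}) ^ p ≤ 2 ^ q := fun h =>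
    Ordinal.opow_le_opow_right two_pos h
  have two_lt : ∀ {p q : Ordinal.{v}}, p < q → (2 : Ordinal.{v}) ^ p < 2 ^ q := fun h =>
    (Ordinal.opow_lt_opow_iff_right one_lt_two).2 h
  obtain ⟨n, hn⟩ := Ordinal.lt_omega0.1 (Ordinal.mod_lt o Ordinal.omega0_ne_zero)
  have ho : ω * (o / ω) + n = o := by rw [← hn, Ordinal.div_add_mod]
  cases n with
  | zero =>
    rw [Nat.cast_zero, add_zero] at ho
    have h2 : (2 : Ordinal.{v}) ^ o = ω ^ (o / ω) := by
      conv_lhs => rw [← ho]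
      exact two_opow_omega0_mul _
    rw [rankLE_iff]
    intro T hT
    obtain ⟨d, hd, hr⟩ := exists_rankLE_biUnion_lt_opow (R := PBad) T
      (fun s => {T' : Finset A | ↑T' ⊆ {y | y ∈ S ∧ Bad s y}}) (o / ω) (by
        intro s hs
        obtain ⟨p, hp, hr⟩ := rankLE_iff.1 h s (hT hs)
        exact ⟨2 ^ p, h2 ▸ two_lt hp, ih p hp hr⟩)
    refine ⟨d, h2 ▸ hd, hr.mono ?_ le_rfl⟩
    rintro T' ⟨hT', hb⟩
    simp only [not_forall, not_exists, not_and] at hb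
    obtain ⟨s, hs, hb⟩ := hb
    simp only [mem_iUnion]
    exact ⟨s, hs, fun y hy => ⟨hT' hy, hb y hy⟩⟩
  | succ n =>
    have ho' : ω * (o / ω) + n + 1 = o := by
      rw [add_assoc]; exact_mod_cast ho
    set p := ω * (o / ω) + (n : Ordinal.{v}) with hpdef
    have hpo : p < o := by rw [← ho']; simp
    by_cases hS : RankLE Bad S p
    · exact (ih p hpo hS).mono subset_rfl (two_mono hpo.le)
    rw [rankLE_iff] at hS
    push Not at hS
    obtain ⟨x, hx, hxp⟩ := hS
    have hmem : ∀ y ∈ S, RankLE Bad {z | z ∈ S ∧ Bad y z} p := by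
      intro y hy
      obtain ⟨q, hq, hr⟩ := rankLE_iff.1 h y hy
      exact hr.mono subset_rfl (Order.le_of_lt_add_one (ho'.symm ▸ hq))
    -- Anything above `x` is equivalent to `x`, since otherwise it could precede `x` in a bad
    -- sequence.
    have hmax : ∀ y ∈ S, x ≤ y → y ≤ x := by
      intro y hy hxy
      by_contra hyx
      obtain ⟨q, hq, hr⟩ := rankLE_iff.1 (hmem y hy) x ⟨hx, hyx⟩
      refine hxp q hq (hr.mono ?_ le_rfl)
      exact fun z hz => ⟨⟨hz.1, fun h => hz.2 (hxy.trans h)⟩, hz.2⟩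
    have h1 := ih p hpo (hmem x hx)
    have h2 : RankLE PBad {T : Finset A | ↑T ⊆ S ∧ ∃ t ∈ T, x ≤ t} (2 ^ p) := by
      refine h1.comap (fun T => T.filter fun t => ¬ x ≤ t) ?_ ?_ le_rfl
      · intro T hT t ht
        simp only [Finset.coe_filter, mem_ofPred_eq] at ht
        exact ⟨hT.1 ht.1, ht.2⟩
      · intro T hT T' hT' hb hd
        refine hb fun t ht => ?_
        by_cases hxt : x ≤ t
        · obtain ⟨t', ht', hxt'⟩ := hT'.2
          exact ⟨t', ht', (hmax t (hT.1 ht) hxt).trans hxt'⟩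
        · obtain ⟨b, hb, htb⟩ := hd t (Finset.mem_filter.2 ⟨ht, hxt⟩)
          exact ⟨b, (Finset.mem_filter.1 hb).1, htb⟩
    have hsum : NatSumLE ((2 : Ordinal.{v}) ^ p) (2 ^ p) (2 ^ o) := by
      have := natSumLE_opow_mul_nat (o / ω) (2 ^ n) (2 ^ n)
      rw [← two_mul, ← pow_succ', ← two_opow_omega0_mul_add, ← two_opow_omega0_mul_add] at this
      rwa [ho] at this
    refine (h1.union h2 hsum).mono ?_ le_rfl
    intro T hT
    by_cases hc : ∃ t ∈ T, x ≤ t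
    · exact Or.inr ⟨hT, hc⟩
    · push Not at hc
      exact Or.inl fun t ht => ⟨hT ht, hc t ht⟩

/-! ### Antichains, sums and products -/

section Operations

variable {A B : Preord.{u}}

theorem antichain_le_iff {k : ℕ} {x y : antichain.{u} k} : x ≤ y ↔ x = y := Iff.rfl

instance (k : ℕ) : Fintype (antichain.{u} k) := inferInstanceAs (Fintype (ULift.{u} (Fin k)))

theorem card_antichain (k : ℕ) : Fintype.card (antichain.{u} k) = k :=
  (Fintype.card_ulift (Fin k)).trans (Fintype.card_fin k)

theorem rankLE_antichain (k : ℕ) : RankLE Bad (univ : Set (antichain.{u} k)) (k : Ordinal.{v}) := by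
  classical
  have key : ∀ (n : ℕ) (S : Finset (antichain.{u} k)), S.card ≤ n →
      RankLE Bad (↑S : Set (antichain.{u} k)) (n : Ordinal.{v}) := by
    intro n
    induction n with
    | zero =>
      intro S hS
      rw [rankLE_iff]
      intro x hx
      simp_all
    | succ n ih =>
      intro S hS
      rw [rankLE_iff]
      intro x hx
      refine ⟨n, by exact_mod_cast Nat.lt_succ_self n, (ih (S.erase x) ?_).mono ?_ le_rfl⟩
      · rw [Finset.card_erase_of_mem hx]; omega
      · rintro y ⟨hy, hxy⟩
        exact Finset.mem_coe.2 (Finset.mem_erase.2 ⟨fun h => hxy h.symm, hy⟩)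
  have := key k Finset.univ (by rw [Finset.card_univ, card_antichain])
  rwa [Finset.coe_univ] at this

theorem rankGE_antichain (k : ℕ) :
    RankGE Incomp (univ : Set (antichain.{u} k)) (k : Ordinal.{v}) := by
  classical
  have key : ∀ (n : ℕ) (S : Finset (antichain.{u} k)), n ≤ S.card →
      RankGE Incomp (↑S : Set (antichain.{u} k)) (n : Ordinal.{v}) := by
    intro n
    induction n with
    | zero => intro S _; exact_mod_cast RankGE.zero
    | succ n ih =>
      intro S hS
      rw [rankGE_iff]
      intro o ho
      obtain ⟨x, hx⟩ : S.Nonempty := Finset.card_pos.1 (by omega)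
      refine ⟨x, hx, (ih (S.erase x) ?_).mono ?_ ?_⟩
      · rw [Finset.card_erase_of_mem hx]; omega
      · intro y hy
        have hy := Finset.mem_erase.1 (Finset.mem_coe.1 hy)
        exact ⟨hy.2, fun h => hy.1 (antichain_le_iff.1 h).symm, fun h => hy.1 h⟩
      · push_cast at ho
        exact Order.lt_add_one_iff.1 ho
  have := key k Finset.univ (by rw [Finset.card_univ, card_antichain])
  rwa [Finset.coe_univ] at this

/-- The element `a` of the summand with index `i`. -/
def lexSum.mk {ι : Type v} [LinearOrder ι] {A : ι → Preord.{u}} (i : ι) (a : A i) : lexSum A :=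
  toLex ⟨i, a⟩

section LexSum
variable {ι : Type v} [LinearOrder ι] {A : ι → Preord.{u}}

theorem lexSum.exists_mk (x : lexSum A) : ∃ i a, x = lexSum.mk i a := ⟨x.1, x.2, rfl⟩

@[simp] theorem lexSum.mk_le_mk_same {i : ι} {a b : A i} :
    (lexSum.mk i a : lexSum A) ≤ lexSum.mk i b ↔ a ≤ b := by
  refine ⟨fun h => ?_, fun h => Sigma.Lex.right _ _ h⟩
  rcases h with ⟨_, _, h⟩ | ⟨_, _, h⟩
  · exact absurd h (lt_irrefl _)
  · exact h

theorem lexSum.mk_le_mk_of_ne {i j : ι} (h : i ≠ j) {a : A i} {b : A j} :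
    (lexSum.mk i a : lexSum A) ≤ lexSum.mk j b ↔ i < j := by
  refine ⟨fun h' => ?_, fun h => Sigma.Lex.left _ _ h⟩
  rcases h' with ⟨_, _, h'⟩ | ⟨_, _, h'⟩
  · exact h'
  · exact absurd rfl h

theorem lexSum.mk_le_mk_of_lt {i j : ι} (h : i < j) (a : A i) (b : A j) :
    (lexSum.mk i a : lexSum A) ≤ lexSum.mk j b := (lexSum.mk_le_mk_of_ne h.ne).2 h

theorem lexSum.le_of_mk_le_mk {i j : ι} {a : A i} {b : A j}
    (h : (lexSum.mk i a : lexSum A) ≤ lexSum.mk j b) : i ≤ j := by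
  by_cases hij : i = j
  · exact hij.le
  · exact ((lexSum.mk_le_mk_of_ne hij).1 h).le

/-- If the summands of index below `i` fit below `s i` and the `i`-th one has rank at most `r i`,
then the whole sum has rank at most any `o` that bounds all `s i + r i`. -/
theorem rankLE_lexSum {s r : ι → Ordinal.{w}} {o : Ordinal.{w}}
    (hr : ∀ i, RankLE Bad (univ : Set (A i)) (r i)) (hs : ∀ i j, i < j → s i + r i ≤ s j)
    (ho : ∀ i, s i + r i ≤ o) : RankLE Bad (univ : Set (lexSum A)) o := by
  -- After a first entry in the `i`-th summand, everything below index `i` and part of that summand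
  -- are still available.
  have key : ∀ (p : Ordinal.{w}) (i : ι) (t : Ordinal.{w}) (T : Set (A i)), s i + t = p →
      RankLE Bad T t → RankLE Bad {x : lexSum A | x.1 < i ∨ ∃ a ∈ T, x = lexSum.mk i a} p := by
    intro p
    induction p using WellFoundedLT.induction with
    | ind p ih =>
      intro i t T hp hT
      rw [rankLE_iff]
      rintro x (hx | ⟨a, ha, rfl⟩)
      · obtain ⟨j, b, rfl⟩ := lexSum.exists_mk x
        have hj : j < i := hx
        obtain ⟨q, hq, hb⟩ := rankLE_iff.1 (hr j) b (mem_univ _)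
        have hlt : s j + q < p := by
          calc s j + q < s j + r j := by gcongr
            _ ≤ s i := hs j i hj
            _ ≤ s i + t := le_self_add
            _ = p := hp
        refine ⟨_, hlt, (ih _ hlt j q _ rfl hb).mono ?_ le_rfl⟩
        rintro y ⟨-, hy⟩
        obtain ⟨k, c, rfl⟩ := lexSum.exists_mk y
        rcases lt_trichotomy k j with hkj | rfl | hkj
        · exact Or.inl hkj
        · exact Or.inr ⟨c, ⟨mem_univ _, fun h => hy (lexSum.mk_le_mk_same.2 h)⟩, rfl⟩
        · exact absurd (lexSum.mk_le_mk_of_lt hkj _ _) hy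
      · obtain ⟨q, hq, hb⟩ := rankLE_iff.1 hT a ha
        have hlt : s i + q < p := by rw [← hp]; gcongr
        refine ⟨_, hlt, (ih _ hlt i q _ rfl hb).mono ?_ le_rfl⟩
        rintro y ⟨hy | ⟨b, hb, rfl⟩, hy'⟩
        · exact Or.inl hy
        · exact Or.inr ⟨b, ⟨hb, fun h => hy' (lexSum.mk_le_mk_same.2 h)⟩, rfl⟩
  rw [rankLE_iff]
  intro x _
  obtain ⟨i, a, rfl⟩ := lexSum.exists_mk x
  obtain ⟨q, hq, hb⟩ := rankLE_iff.1 (hr i) a (mem_univ _)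
  have hlt : s i + q < o := lt_of_lt_of_le (by gcongr) (ho i)
  refine ⟨_, hlt, (key _ i q _ rfl hb).mono ?_ le_rfl⟩
  rintro y ⟨-, hy⟩
  obtain ⟨k, c, rfl⟩ := lexSum.exists_mk y
  rcases lt_trichotomy k i with hki | rfl | hki
  · exact Or.inl hki
  · exact Or.inr ⟨c, ⟨mem_univ _, fun h => hy (lexSum.mk_le_mk_same.2 h)⟩, rfl⟩
  · exact absurd (lexSum.mk_le_mk_of_lt hki _ _) hy

end LexSum

theorem lexProd_le_iff {p q : lexProd A B} :
    p ≤ q ↔ p.2 ≤ q.2 ∧ (p.2 ≤ q.2 ∧ q.2 ≤ p.2 → p.1 ≤ q.1) := Iff.rfl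

/-- The rank of the first factor is required to be a power of `ω`: entering incomparable fibres of
the product leaves several of them partly used, and their natural sum has to stay below it. -/
theorem rankLE_lexProd {c b : Ordinal.{v}} (hA : RankLE Bad (univ : Set A) (ω ^ c))
    (hB : RankLE Bad (univ : Set B) b) :
    RankLE Bad (univ : Set (lexProd A B)) (ω ^ c * b) := by
  -- The part `Y` collects what is left of the finitely many fibres already entered.
  have key : ∀ (b : Ordinal.{v}) (S : Set B) (e : Ordinal.{v}) (Y : Set (lexProd A B)),
      RankLE Bad S b → RankLE Bad Y e → e < ω ^ c →
      RankLE Bad ({p : lexProd A B | p.2 ∈ S} ∪ Y) (ω ^ c * b + e) := by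
    intro b
    induction b using WellFoundedLT.induction with
    | ind b ihb =>
    intro S e
    induction e using WellFoundedLT.induction with
    | ind e ihe =>
      intro Y hS hY he
      rw [rankLE_iff]
      rintro p (hp | hp)
      · obtain ⟨b', hb', hr⟩ := rankLE_iff.1 hS p.2 hp
        obtain ⟨a', ha', hr'⟩ := rankLE_iff.1 hA p.1 (mem_univ _)
        have hZ : RankLE Bad {q : lexProd A B | p.2 ≤ q.2 ∧ q.2 ≤ p.2 ∧ Bad p.1 q.1} a' := by
          refine hr'.comap (fun q => q.1) (fun q hq => ⟨mem_univ _, hq.2.2⟩) ?_ le_rfl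
          intro q hq q' hq' hb h
          exact hb (lexProd_le_iff.2 ⟨hq.2.1.trans hq'.1, fun _ => h⟩)
        obtain ⟨d, hd, hd'⟩ := hY.exists_union_lt_opow hZ he ha'
        refine ⟨ω ^ c * b' + d, ?_, (ihb b' hb' _ d _ hr hd' hd).mono ?_ le_rfl⟩
        · calc ω ^ c * b' + d < ω ^ c * b' + ω ^ c := by gcongr
            _ = ω ^ c * (b' + 1) := by rw [mul_add_one]
            _ ≤ ω ^ c * b := by gcongr; exact Order.add_one_le_of_lt hb'
            _ ≤ _ := le_self_add
        · rintro q ⟨hq | hq, hpq⟩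
          · by_cases h1 : p.2 ≤ q.2
            · refine Or.inr (Or.inr ?_)
              by_contra h2
              refine hpq (lexProd_le_iff.2 ⟨h1, fun h3 => ?_⟩)
              by_contra h4
              exact h2 ⟨h1, h3.2, h4⟩
            · exact Or.inl ⟨hq, h1⟩
          · exact Or.inr (Or.inl hq)
      · obtain ⟨e', he', hr⟩ := rankLE_iff.1 hY p hp
        refine ⟨ω ^ c * b + e', by gcongr, (ihe e' he' _ hS hr (he'.trans he)).mono ?_ le_rfl⟩
        rintro q ⟨hq | hq, hpq⟩
        exacts [Or.inl hq, Or.inr ⟨hq, hpq⟩]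
  have h0 : RankLE Bad (∅ : Set (lexProd A B)) (0 : Ordinal.{v}) := rankLE_iff.2 (by simp)
  simpa using key b univ 0 ∅ hB h0 (Ordinal.opow_pos c Ordinal.omega0_pos)

/-- A full antichain sequence in the fibre over `y` is followed by one in the fibres over the
elements incomparable to `y`. -/
theorem rankGE_lexProd_of_subset {a b : Ordinal.{v}} (hA : RankGE Incomp (univ : Set A) a)
    {S : Set B} (hB : RankGE Incomp S b) :
    RankGE Incomp {p : lexProd A B | p.2 ∈ S} (a * b) := by
  induction b using WellFoundedLT.induction generalizing S with
  | ind b ih =>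
    refine RankGE.of_forall_lt fun p hp => ?_
    have ha : a ≠ 0 := by rintro rfl; simp at hp
    have hb : p / a < b := (Ordinal.lt_mul_iff_div_lt ha).1 hp
    obtain ⟨y, hy, hr⟩ := rankGE_iff.1 hB _ hb
    refine ⟨a * (p / a) + a, Ordinal.lt_mul_div_add p ha, ?_⟩
    have hX : RankGE Incomp {q : lexProd A B | q.2 = y} a :=
      hA.map (fun x => ((x, y) : A × B)) (fun x _ => rfl) (fun x _ x' _ h =>
        ⟨fun h' => h.1 ((lexProd_le_iff.1 h').2 ⟨le_rfl, le_rfl⟩),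
          fun h' => h.2 ((lexProd_le_iff.1 h').2 ⟨le_rfl, le_rfl⟩)⟩) le_rfl
    refine (hX.add (b := a * (p / a))
      (Y := {p : lexProd A B | p.2 ∈ {z | z ∈ S ∧ Incomp y z}})
      (fun G hG => (ih _ hb hr).mono ?_ le_rfl)).mono ?_ le_rfl
    · refine fun q hq => ⟨hq, fun g hg => ?_⟩
      have hgy : g.2 = y := hG hg
      have h2 := hq.2
      rw [← hgy] at h2
      exact ⟨fun h => h2.1 h.1, fun h => h2.2 h.1⟩
    · rintro q (hq | hq)
      · have hqy : q.2 = y := hq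
        change q.2 ∈ S
        rwa [hqy]
      · exact hq.1

/-- The inclusion of the first summand. -/
def disjSum.inl (a : A) : disjSum A B := (Sum.inl a : A ⊕ B)

/-- The inclusion of the second summand. -/
def disjSum.inr (b : B) : disjSum A B := (Sum.inr b : A ⊕ B)

theorem disjSum.range_union : range (disjSum.inl : A → disjSum A B) ∪ range disjSum.inr = univ := by
  ext x
  rcases (x : A ⊕ B) with a | b
  · exact iff_of_true (Or.inl ⟨a, rfl⟩) trivial
  · exact iff_of_true (Or.inr ⟨b, rfl⟩) trivial

@[simp] theorem disjSum.inl_le_inl {a a' : A} :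
    (disjSum.inl a : disjSum A B) ≤ disjSum.inl a' ↔ a ≤ a' := Sum.inl_le_inl_iff

@[simp] theorem disjSum.inr_le_inr {b b' : B} :
    (disjSum.inr b : disjSum A B) ≤ disjSum.inr b' ↔ b ≤ b' := Sum.inr_le_inr_iff

@[simp] theorem disjSum.not_inl_le_inr {a : A} {b : B} :
    ¬ (disjSum.inl a : disjSum A B) ≤ disjSum.inr b := Sum.not_inl_le_inr

@[simp] theorem disjSum.not_inr_le_inl {a : A} {b : B} :
    ¬ (disjSum.inr b : disjSum A B) ≤ disjSum.inl a := Sum.not_inr_le_inl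

theorem rankLE_disjSum {a b c : Ordinal.{v}} (hA : RankLE Bad (univ : Set A) a)
    (hB : RankLE Bad (univ : Set B) b) (h : NatSumLE a b c) :
    RankLE Bad (univ : Set (disjSum A B)) c := by
  have h1 := hA.image (R' := Bad) (disjSum.inl : A → disjSum A B)
    (fun x y h => fun h' => h (disjSum.inl_le_inl.2 h'))
  have h2 := hB.image (R' := Bad) (disjSum.inr : B → disjSum A B)
    (fun x y h => fun h' => h (disjSum.inr_le_inr.2 h'))
  rw [image_univ] at h1 h2
  have := h1.union h2 h
  rwa [disjSum.range_union] at this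

theorem rankGE_disjSum {a b : Ordinal.{v}} (hA : RankGE Incomp (univ : Set A) a)
    (hB : RankGE Incomp (univ : Set B) b) :
    RankGE Incomp (univ : Set (disjSum A B)) (a + b) := by
  have h1 : RankGE Incomp (range (disjSum.inl : A → disjSum A B)) a :=
    hA.map disjSum.inl (fun x _ => ⟨x, rfl⟩) (fun x _ y _ h => by simpa [Incomp] using h) le_rfl
  have h2 : RankGE Incomp (range (disjSum.inr : B → disjSum A B)) b :=
    hB.map disjSum.inr (fun x _ => ⟨x, rfl⟩) (fun x _ y _ h => by simpa [Incomp] using h) le_rfl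
  refine (h2.add (b := a) (Y := range disjSum.inl) fun G hG => h1.mono ?_ le_rfl).mono
    (subset_univ _) le_rfl
  rintro _ ⟨x, rfl⟩
  refine ⟨⟨x, rfl⟩, fun g hg => ?_⟩
  obtain ⟨y, rfl⟩ := hG hg
  simp [Incomp]

end Operations

/-! ### The finitary powerset: lower bounds -/

/-- The nonempty finite subsets of `A` have antichain rank at least `κ`. -/
def PowWidthGE (A : Type u) [LE A] (κ : Ordinal.{v}) : Prop :=
  RankGE PIncomp {T : Finset A | T.Nonempty} κ

/-- The finite subsets of `A` have antichain rank at least `κ`, even after the removal of the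
subsets dominated by a given finite subset. -/
def PowWidthRobust (A : Type u) [LE A] (κ : Ordinal.{v}) : Prop :=
  ∀ G : Finset A, RankGE PIncomp {T : Finset A | ¬ Dom T G} κ

section Maps

variable {A : Type u} {B : Type w} [Preorder A] [Preorder B] {κ : Ordinal.{v}}

theorem PowWidthRobust.powWidthGE (h : PowWidthRobust A κ) : PowWidthGE A κ := by
  refine (h ∅).mono (fun T hT => ?_) le_rfl
  rw [mem_ofPred_eq, Finset.nonempty_iff_ne_empty]
  rintro rfl
  exact hT fun a ha => absurd ha (Finset.notMem_empty a)

theorem PowWidthGE.rankGE_pBad (h : PowWidthGE A κ) :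
    RankGE PBad (univ : Set (Finset A)) κ :=
  h.map id (mapsTo_univ _ _) (fun _ _ _ _ h => h.1) le_rfl

theorem powWidthGE_of_rankGE (h : RankGE Incomp (univ : Set A) κ) : PowWidthGE A κ :=
  h.map (fun x => {x}) (fun x _ => Finset.singleton_nonempty x)
    (fun x _ y _ h => by simpa [PIncomp, Dom, Incomp] using h) le_rfl

open Classical in
theorem dom_of_dom_image {f : A → B} (hf : ∀ x y, f x ≤ f y → x ≤ y) {S T : Finset A}
    (h : Dom (S.image f) (T.image f)) : Dom S T := by
  intro a ha
  obtain ⟨b, hb, hab⟩ := h (f a) (Finset.mem_image_of_mem f ha)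
  obtain ⟨c, hc, rfl⟩ := Finset.mem_image.1 hb
  exact ⟨c, hc, hf a c hab⟩

theorem RankGE.pBad_of_reflecting (h : RankGE PBad (univ : Set (Finset A)) κ) (f : A → B)
    (hf : ∀ x y, f x ≤ f y → x ≤ y) : RankGE PBad (univ : Set (Finset B)) κ := by
  classical
  exact h.map (fun T => T.image f) (mapsTo_univ _ _)
    (fun S _ T _ h h' => h (dom_of_dom_image hf h')) le_rfl

theorem PowWidthGE.image (h : PowWidthGE A κ) (f : A → B) (hf : ∀ x y, f x ≤ f y → x ≤ y) :
    RankGE PIncomp {T : Finset B | T.Nonempty ∧ ∀ t ∈ T, t ∈ range f} κ := by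
  classical
  refine RankGE.map h (fun T => T.image f) (fun T hT => ⟨hT.image f, fun t ht => ?_⟩)
    (fun S _ T _ h => ⟨fun h' => h.1 (dom_of_dom_image hf h'),
      fun h' => h.2 (dom_of_dom_image hf h')⟩) le_rfl
  obtain ⟨a, -, rfl⟩ := Finset.mem_image.1 ht
  exact ⟨a, rfl⟩

theorem PowWidthGE.of_reflecting (h : PowWidthGE A κ) (f : A → B)
    (hf : ∀ x y, f x ≤ f y → x ≤ y) : PowWidthGE B κ :=
  (h.image f hf).mono (fun _ hT => hT.1) le_rfl

theorem PowWidthRobust.of_equiv (h : PowWidthRobust A κ) (e : A ≃ B)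
    (he : ∀ x y, e x ≤ e y → x ≤ y) : PowWidthRobust B κ := by
  classical
  intro G
  refine (h (G.image e.symm)).map (fun T => T.image e) (fun T hT hd => hT ?_)
    (fun S _ T _ h => ⟨fun h' => h.1 (dom_of_dom_image he h'),
      fun h' => h.2 (dom_of_dom_image he h')⟩) le_rfl
  intro a ha
  obtain ⟨b, hb, hab⟩ := hd (e a) (Finset.mem_image_of_mem e ha)
  exact ⟨e.symm b, Finset.mem_image_of_mem _ hb, he _ _ (by simpa using hab)⟩

end Maps

section DisjSum

variable {A B : Preord.{u}} {κ q : Ordinal.{v}}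

open Classical in
/-- The finite subset of a disjoint sum with given parts in the two summands. -/
noncomputable def disjUnion (S : Finset A) (T : Finset B) : Finset (disjSum A B) :=
  S.image disjSum.inl ∪ T.image disjSum.inr

theorem dom_disjUnion_iff {S S' : Finset A} {T T' : Finset B} :
    Dom (disjUnion S T) (disjUnion S' T') ↔ Dom S S' ∧ Dom T T' := by
  classical
  simp [Dom, disjUnion, or_imp, forall_and, or_and_right, exists_or]

open Classical in
/-- The part of a finite subset of a disjoint sum in the first summand. -/
noncomputable def leftPart (G : Finset (disjSum A B)) : Finset A :=
  G.preimage disjSum.inl fun _ _ _ _ h => Sum.inl_injective h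

theorem dom_leftPart {S : Finset A} {T : Finset B} {G : Finset (disjSum A B)}
    (h : Dom (disjUnion S T) G) : Dom S (leftPart G) := by
  classical
  intro a ha
  obtain ⟨b, hb, hab⟩ := h (disjSum.inl a) 
    (Finset.mem_union_left _ (Finset.mem_image_of_mem _ ha))
  rcases (show b ∈ range disjSum.inl ∪ range disjSum.inr from
    disjSum.range_union ▸ mem_univ b) with ⟨c, rfl⟩ | ⟨c, rfl⟩
  · exact ⟨c, Finset.mem_preimage.2 hb, by simpa using hab⟩
  · simp at hab

/-- The pairs with second coordinate `y`, enumerated along a bad sequence of subsets of `A`, are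
followed by pairs whose second coordinate does not dominate `y`. -/
theorem rankGE_pBad_disjSum (hA : RankGE PBad (univ : Set (Finset A)) κ)
    (hB : RankGE PBad (univ : Set (Finset B)) q) :
    RankGE PBad (univ : Set (Finset (disjSum A B))) (κ * q) := by
  have key : ∀ S : Set (Finset B), RankGE PBad S q →
      RankGE PBad {U : Finset (disjSum A B) | ∃ T₁, ∃ T₂ ∈ S, U = disjUnion T₁ T₂} (κ * q) := by
    clear hB
    induction q using WellFoundedLT.induction with
    | ind q ih =>
      intro S hS
      refine RankGE.of_forall_lt fun p hp => ?_
      have ha : κ ≠ 0 := by rintro rfl; simp at hp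
      have hb : p / κ < q := (Ordinal.lt_mul_iff_div_lt ha).1 hp
      obtain ⟨y, hy, hr⟩ := rankGE_iff.1 hS _ hb
      refine ⟨κ * (p / κ) + κ, Ordinal.lt_mul_div_add p ha, ?_⟩
      have hX : RankGE PBad {U : Finset (disjSum A B) | ∃ T₁, U = disjUnion T₁ y} κ :=
        hA.map (fun T => disjUnion T y) (fun T _ => ⟨T, rfl⟩)
          (fun T _ T' _ h h' => h (dom_disjUnion_iff.1 h').1) le_rfl
      refine (hX.add fun G hG => (ih _ hb _ hr).mono ?_ le_rfl).mono
        (union_subset (t := {U : Finset (disjSum A B) | ∃ T₁, ∃ T₂ ∈ S, U = disjUnion T₁ T₂})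
          ?_ subset_rfl) le_rfl
      · rintro _ ⟨T₁, T₂, hT₂, rfl⟩
        refine ⟨⟨T₁, T₂, hT₂.1, rfl⟩, fun g hg => ?_⟩
        obtain ⟨T', rfl⟩ := hG hg
        exact fun h => hT₂.2 (dom_disjUnion_iff.1 h).2
      · rintro _ ⟨T₁, rfl⟩
        exact ⟨T₁, y, hy, rfl⟩
  exact (key univ hB).mono (subset_univ _) le_rfl

/-- The powerset of `A ⊔ B` is the product of those of `A` and `B`. Along a bad sequence of finite
subsets of `B`, each entry `y` is paired with a full antichain sequence of subsets of `A`; by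
robustness, the sets used so far in the first coordinate do not reduce the rank of the rest. -/
theorem PowWidthRobust.disjSum (hA : PowWidthRobust A κ)
    (hB : RankGE PBad (univ : Set (Finset B)) q) :
    PowWidthRobust (disjSum A B) (κ * q) := by
  classical
  have key : ∀ (S : Set (Finset B)) (G : Finset A), RankGE PBad S q →
      RankGE PIncomp {U : Finset (PfTight.disjSum A B) |
        ∃ T₁, ¬ Dom T₁ G ∧ ∃ T₂ ∈ S, U = disjUnion T₁ T₂} (κ * q) := by
    clear hB
    induction q using WellFoundedLT.induction with
    | ind q ih =>
      intro S G hS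
      refine RankGE.of_forall_lt fun p hp => ?_
      have ha : κ ≠ 0 := by rintro rfl; simp at hp
      have hb : p / κ < q := (Ordinal.lt_mul_iff_div_lt ha).1 hp
      obtain ⟨y, hy, hr⟩ := rankGE_iff.1 hS _ hb
      refine ⟨κ * (p / κ) + κ, Ordinal.lt_mul_div_add p ha, ?_⟩
      have hX : RankGE PIncomp {U : Finset (PfTight.disjSum A B) |
          ∃ T₁, ¬ Dom T₁ G ∧ U = disjUnion T₁ y} κ :=
        (hA G).map (fun T => disjUnion T y) (fun T hT => ⟨T, hT, rfl⟩)
          (fun T _ T' _ h => ⟨fun h' => h.1 (dom_disjUnion_iff.1 h').1,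
            fun h' => h.2 (dom_disjUnion_iff.1 h').1⟩) le_rfl
      -- The first coordinates of the sets in `F`, already used, are added to the set `G` that may
      -- not dominate later ones.
      refine (hX.add fun F hF => (ih _ hb _ (G ∪ F.biUnion leftPart) hr).mono ?_ le_rfl).mono
        (union_subset (t := {U : Finset (PfTight.disjSum A B) |
          ∃ T₁, ¬ Dom T₁ G ∧ ∃ T₂ ∈ S, U = disjUnion T₁ T₂}) ?_ subset_rfl) le_rfl
      · rintro _ ⟨T₁, hT₁, T₂, hT₂, rfl⟩
        refine ⟨⟨T₁, fun h => hT₁ fun a ha => ?_, T₂, hT₂.1, rfl⟩, fun g hg => ⟨?_, fun h => ?_⟩⟩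
        · obtain ⟨b, hb, hab⟩ := h a ha
          exact ⟨b, Finset.mem_union_left _ hb, hab⟩
        · obtain ⟨T', -, rfl⟩ := hF hg
          exact fun h => hT₂.2 (dom_disjUnion_iff.1 h).2
        · refine hT₁ fun a ha => ?_
          obtain ⟨b, hb, hab⟩ := dom_leftPart h a ha
          exact ⟨b, Finset.mem_union_right _ (Finset.mem_biUnion.2 ⟨g, hg, hb⟩), hab⟩
      · rintro _ ⟨T₁, hT₁, rfl⟩
        exact ⟨T₁, hT₁, y, hy, rfl⟩
  intro G
  refine (key univ (leftPart G) hB).mono ?_ le_rfl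
  rintro _ ⟨T₁, hT₁, T₂, -, rfl⟩
  exact fun h => hT₁ (dom_leftPart h)

theorem rankGE_pBad_disjSumList {ι : Type*} (l : List ι) (F : ι → Preord.{u}) (q : ι → Ordinal.{v})
    (h : ∀ i ∈ l, RankGE PBad (univ : Set (Finset (F i))) (q i)) :
    RankGE PBad (univ : Set (Finset (disjSumList (l.map F)))) (l.map q).prod := by
  induction l with
  | nil => exact RankGE.one univ_nonempty
  | cons i l ih =>
    match l, ih with
    | [], _ =>
      simp only [List.map_cons, List.map_nil, List.prod_singleton]
      exact h i (by simp)
    | j :: l, ih =>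
      exact rankGE_pBad_disjSum (h i (by simp)) (ih fun k hk => h k (List.mem_cons_of_mem _ hk))

theorem PowWidthRobust.disjSumList {ι : Type*} {i : ι} {l : List ι} {F : ι → Preord.{u}}
    {q : ι → Ordinal.{v}} (hi : PowWidthRobust (F i) (q i))
    (h : ∀ i ∈ l, RankGE PBad (univ : Set (Finset (F i))) (q i)) :
    PowWidthRobust (disjSumList ((i :: l).map F)) ((i :: l).map q).prod := by
  match l with
  | [] =>
    simp only [List.map_cons, List.map_nil, List.prod_singleton]
    exact hi
  | j :: l => exact hi.disjSum (rankGE_pBad_disjSumList (j :: l) F q h)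

end DisjSum

/-- Only finitely many indices are met by a given finite set, so a lexicographic sum whose summands
have large powersets cofinally often has a robustly wide powerset. -/
theorem powWidthRobust_lexSum {ι : Type u} [LinearOrder ι] [Nonempty ι] {A : ι → Preord.{v}}
    {κ : Ordinal} (h : ∀ i, ∀ p < κ, ∃ j > i, ∃ q > p, PowWidthGE (A j) q) :
    PowWidthRobust (lexSum A) κ := by
  classical
  intro G
  obtain ⟨i, hi⟩ := (G.image fun x => x.1).exists_le
  -- Nonempty subsets of a summand of index beyond `i` are not dominated by `G`.
  refine RankGE.of_forall_lt fun p hp => ?_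
  obtain ⟨j, hj, q, hq, hw⟩ := h i p hp
  refine ⟨q, hq, (hw.image (lexSum.mk j) (fun x y => lexSum.mk_le_mk_same.1)).mono ?_ le_rfl⟩
  rintro T ⟨⟨t, ht⟩, hT⟩ hd
  obtain ⟨g, hg, htg⟩ := hd t ht
  obtain ⟨a, rfl⟩ := hT t ht
  obtain ⟨k, b, rfl⟩ := lexSum.exists_mk g
  exact absurd (lexSum.le_of_mk_le_mk htg)
    (not_le.2 ((hi k (Finset.mem_image_of_mem (fun x : lexSum A => x.1) hg)).trans_lt hj))

section LexProd

variable {A B C : Preord.{u}}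

/-- Lexicographic products are associative. -/
def lexProdAssoc : lexProd (lexProd A B) C ≃ lexProd A (lexProd B C) :=
  Equiv.prodAssoc A B C

theorem le_of_lexProdAssoc_le {x y : lexProd (lexProd A B) C}
    (h : lexProdAssoc x ≤ lexProdAssoc y) : x ≤ y := by
  obtain ⟨⟨a, b⟩, c⟩ := x
  obtain ⟨⟨a', b'⟩, c'⟩ := y
  obtain ⟨⟨hc, hb⟩, ha⟩ := h
  exact ⟨hc, fun e => ⟨hb e, fun e' => ha ⟨⟨hc, hb⟩, e.2, fun _ => e'.2⟩⟩⟩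

/-- Lexicographic products distribute over lexicographic sums on the right. -/
def lexProdLexSum {ι : Type v} [LinearOrder ι] (A : Preord.{max v u}) (B : ι → Preord.{max v u}) :
    lexSum (fun i => lexProd A (B i)) ≃ lexProd A (lexSum B) where
  toFun x := (x.2.1, lexSum.mk x.1 x.2.2)
  invFun y := lexSum.mk y.2.1 (y.1, y.2.2)
  left_inv _ := rfl
  right_inv _ := rfl

theorem le_of_lexProdLexSum_le {ι : Type v} [LinearOrder ι] {A : Preord.{max v u}}
    {B : ι → Preord.{max v u}} {x y : lexSum fun i => lexProd A (B i)}
    (h : lexProdLexSum A B x ≤ lexProdLexSum A B y) : x ≤ y := by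
  obtain ⟨i, ⟨a, b⟩, rfl⟩ := lexSum.exists_mk x
  obtain ⟨j, ⟨a', b'⟩, rfl⟩ := lexSum.exists_mk y
  obtain ⟨h1, h2⟩ := h
  change (lexSum.mk i b : lexSum B) ≤ lexSum.mk j b' at h1
  change (lexSum.mk i b : lexSum B) ≤ lexSum.mk j b' ∧ (lexSum.mk j b' : lexSum B) ≤ lexSum.mk i b →
    a ≤ a' at h2
  rcases lt_trichotomy i j with hij | rfl | hij
  · exact lexSum.mk_le_mk_of_lt hij _ _
  · simp only [lexSum.mk_le_mk_same] at h1 h2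
    exact lexSum.mk_le_mk_same.2 ⟨h1, h2⟩
  · exact absurd (lexSum.le_of_mk_le_mk h1) (not_le.2 hij)

/-- The embedding of `A ⊔ A · Γ_n` into `A · Γ_{n + 1}`. -/
def lexProdAntichainSucc (n : ℕ) :
    disjSum A (lexProd A (antichain n)) → lexProd A (antichain (n + 1)) :=
  Sum.elim (fun a => (a, ULift.up (Fin.last n))) fun p => (p.1, ULift.up p.2.down.castSucc)

theorem le_of_lexProdAntichainSucc_le (n : ℕ) (x y : disjSum A (lexProd A (antichain n)))
    (h : lexProdAntichainSucc n x ≤ lexProdAntichainSucc n y) : x ≤ y := by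
  have hx : x ∈ range disjSum.inl ∪ range disjSum.inr := disjSum.range_union ▸ mem_univ x
  have hy : y ∈ range disjSum.inl ∪ range disjSum.inr := disjSum.range_union ▸ mem_univ y
  have aux : ∀ i : Fin n, i.castSucc ≠ Fin.last n := fun i => (Fin.castSucc_lt_last i).ne
  rcases hx with ⟨a, rfl⟩ | ⟨⟨a, i⟩, rfl⟩ <;> rcases hy with ⟨b, rfl⟩ | ⟨⟨b, j⟩, rfl⟩
  · exact disjSum.inl_le_inl.2 (h.2 ⟨rfl, rfl⟩)
  · exact absurd (congrArg ULift.down h.1).symm (aux _)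
  · exact absurd (congrArg ULift.down h.1) (aux _)
  · have hij : i = j := ULift.ext _ _ (Fin.castSucc_injective n (congrArg ULift.down h.1))
    subst hij
    exact disjSum.inr_le_inr.2 ⟨rfl, fun _ => h.2 ⟨rfl, rfl⟩⟩

theorem PowWidthRobust.rankGE_pBad_lexProd_antichain {κ : Ordinal.{v}} (h : PowWidthRobust A κ)
    (n : ℕ) : RankGE PBad (univ : Set (Finset (lexProd A (antichain n)))) (κ ^ n) := by
  induction n with
  | zero => rw [pow_zero]; exact RankGE.one univ_nonempty
  | succ n ih =>
    rw [pow_succ']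
    exact (rankGE_pBad_disjSum h.powWidthGE.rankGE_pBad ih).pBad_of_reflecting _
      (le_of_lexProdAntichainSucc_le n)

theorem PowWidthRobust.powWidthGE_lexProd_antichain {κ : Ordinal.{v}} (h : PowWidthRobust A κ)
    (n : ℕ) : PowWidthGE (lexProd A (antichain (n + 1))) (κ ^ (n + 1)) := by
  rw [pow_succ']
  exact (h.disjSum (h.rankGE_pBad_lexProd_antichain n)).powWidthGE.of_reflecting _
    (le_of_lexProdAntichainSucc_le n)

end LexProd

/-! ### The family `H` -/

theorem HOpow_zero : HOpow.{u} 0 = antichain 1 := by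
  rw [HOpow, if_pos rfl]

theorem HOpow_one : HOpow.{u} 1 = lexSum fun n : ℕ => antichain n := by
  rw [HOpow, if_neg one_ne_zero, if_pos rfl]

theorem HOpow_opow {a : Ordinal.{u}} (ha : a ≠ 0) :
    HOpow (ω ^ a) = lexSum fun b : (ω ^ a : Ordinal.{u}).ToType => HOpow b.toOrd.1 := by
  have h1 : (1 : Ordinal.{u}) < ω ^ a := Ordinal.one_lt_opow.2 ⟨Ordinal.one_lt_omega0, ha⟩
  rw [HOpow, if_neg (zero_lt_one.trans h1).ne', if_neg h1.ne', if_pos ⟨a, rfl⟩]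

theorem HOpow_of_not_opow {γ : Ordinal.{u}} (h0 : γ ≠ 0) (h : ¬ ∃ a : Ordinal.{u}, γ = ω ^ a) :
    HOpow γ = lexProdList ((cnfExponents γ).map fun a => HOpow (ω ^ a)) := by
  have h1 : γ ≠ 1 := by
    rintro rfl
    exact h ⟨0, (Ordinal.opow_zero _).symm⟩
  rw [HOpow, if_neg h0, if_neg h1, if_neg h]
  congr 1
  simp

/-- Induction along the definition of `HOpow`. -/
theorem HOpow_induction {P : Ordinal.{u} → Preord.{u} → Prop} (zero : P 0 (antichain 1))
    (one : P 1 (lexSum fun n : ℕ => antichain n))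
    (opow : ∀ a : Ordinal.{u}, a ≠ 0 → (∀ β < ω ^ a, P β (HOpow β)) →
      P (ω ^ a) (lexSum fun b : (ω ^ a : Ordinal.{u}).ToType => HOpow b.toOrd.1))
    (mul : ∀ (a δ : Ordinal.{u}) (B : Preord.{u}), P (ω ^ a) (HOpow (ω ^ a)) → P δ B →
      P (ω ^ a + δ) (lexProd (HOpow (ω ^ a)) B)) (γ : Ordinal.{u}) : P γ (HOpow γ) := by
  induction γ using WellFoundedLT.induction with
  | ind γ ih =>
    by_cases h0 : γ = 0
    · rw [h0, HOpow_zero]; exact zero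
    by_cases h : ∃ a : Ordinal.{u}, γ = ω ^ a
    · obtain ⟨a, rfl⟩ := h
      by_cases ha : a = 0
      · rw [ha, Ordinal.opow_zero, HOpow_one]; exact one
      · rw [HOpow_opow ha]; exact opow a ha ih
    · have key : ∀ l : List Ordinal.{u}, l ≠ [] → (∀ a ∈ l, P (ω ^ a) (HOpow (ω ^ a))) →
          P (l.map fun e => ω ^ e).sum (lexProdList (l.map fun a => HOpow (ω ^ a))) := by
        intro l
        induction l with
        | nil => exact fun h => absurd rfl h
        | cons a l ihl =>
          intro _ hl
          match l, ihl with
          | [], _ =>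
            simp only [List.map_cons, List.map_nil, List.sum_singleton]
            exact hl a (by simp)
          | b :: l, ihl =>
            exact mul a _ _ (hl a (by simp))
              (ihl (by simp) fun c hc => hl c (List.mem_cons_of_mem _ hc))
      rw [HOpow_of_not_opow h0 h]
      have := key (cnfExponents γ) (fun h => h0 ?_) fun a ha =>
        ih _ (opow_lt_of_mem_cnfExponents ha h)
      · rwa [sum_cnfExponents] at this
      · rw [← sum_cnfExponents γ, h]; rfl

theorem isSuccLimit_omega0_opow {a : Ordinal.{u}} (ha : a ≠ 0) :
    IsSuccLimit (ω ^ a : Ordinal.{u}) :=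
  Ordinal.isSuccLimit_opow_left Ordinal.isSuccLimit_omega0 ha

theorem rankLE_HOpow (γ : Ordinal.{u}) : RankLE Bad (univ : Set (HOpow γ)) (ω ^ γ) := by
  induction γ using HOpow_induction with
  | zero => simpa using rankLE_antichain.{u, u} 1
  | one =>
    -- `n ^ 2` bounds the number of elements in the summands before `Γ_n`.
    refine rankLE_lexSum (s := fun n => ((n * n : ℕ) : Ordinal.{u}))
      (r := fun n => (n : Ordinal.{u}))
      rankLE_antichain ?_ ?_
    · intro i j hij
      norm_cast
      nlinarith
    · intro i
      rw [Ordinal.opow_one]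
      exact_mod_cast (Ordinal.natCast_lt_omega0 _).le
  | opow a ha ih =>
    have aux : ∀ β δ : Ordinal.{u}, β < δ → (ω ^ β + ω ^ β : Ordinal.{u}) ≤ ω ^ δ := fun β δ h =>
      have h := (Ordinal.opow_lt_opow_iff_right Ordinal.one_lt_omega0).2 h
      (Ordinal.isPrincipal_add_omega0_opow δ h h).le
    -- As powers of `ω` are additively principal, the summands of index below `b` fit below `ω ^ b`.
    refine rankLE_lexSum (s := fun b => ω ^ b.toOrd.1) (r := fun b => ω ^ b.toOrd.1)
      (fun b => ih _ b.toOrd.2) ?_ ?_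
    · intro i j hij
      exact aux _ _ (by simpa using hij)
    · exact fun i => aux _ _ i.toOrd.2
  | mul a δ B hA hB =>
    rw [Ordinal.opow_add]
    exact rankLE_lexProd hA hB

theorem rankGE_HOpow (γ : Ordinal.{u}) : RankGE Incomp (univ : Set (HOpow γ)) (ω ^ γ) := by
  have summand : ∀ {ι : Type u} [LinearOrder ι] (A : ι → Preord.{u}) (i : ι) (o : Ordinal.{u}),
      RankGE Incomp (univ : Set (A i)) o → RankGE Incomp (univ : Set (lexSum A)) o :=
    fun A i o h => h.map (lexSum.mk i) (mapsTo_univ _ _)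
      (fun x _ y _ h => by simpa [Incomp] using h) le_rfl
  induction γ using HOpow_induction with
  | zero => simpa using rankGE_antichain.{u, u} 1
  | one =>
    refine RankGE.of_forall_lt fun p hp => ?_
    rw [Ordinal.opow_one] at hp
    obtain ⟨n, rfl⟩ := Ordinal.lt_omega0.1 hp
    refine ⟨(n + 1 : ℕ), by exact_mod_cast n.lt_succ_self, ?_⟩
    exact (rankGE_antichain (n + 1)).map (lexSum.mk (A := fun n : ℕ => antichain n) (n + 1))
      (mapsTo_univ _ _) (fun x _ y _ h => by simpa [Incomp] using h) le_rfl
  | opow a ha ih =>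
    refine RankGE.of_forall_lt fun p hp => ?_
    obtain ⟨β, hβ, hpβ⟩ := (Ordinal.lt_opow_of_isSuccLimit Ordinal.omega0_ne_zero
      (isSuccLimit_omega0_opow ha)).1 hp
    refine ⟨_, hpβ, ?_⟩
    have hj : (Ordinal.ToType.mk ⟨β, hβ⟩).toOrd.1 = β := by simp
    refine summand _ (Ordinal.ToType.mk ⟨β, hβ⟩) _ ?_
    rw [hj]
    exact ih β hβ
  | mul a δ B hA hB =>
    rw [Ordinal.opow_add]
    exact (rankGE_lexProd_of_subset hA hB).mono (subset_univ _) le_rfl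

theorem lt_opow_omega0_iff {κ p : Ordinal.{u}} (hκ : κ ≠ 0) :
    p < κ ^ ω ↔ ∃ n : ℕ, p < κ ^ n := by
  rw [Ordinal.lt_opow_of_isSuccLimit hκ Ordinal.isSuccLimit_omega0]
  constructor
  · rintro ⟨_, h, hp⟩
    obtain ⟨n, rfl⟩ := Ordinal.lt_omega0.1 h
    exact ⟨n, by rwa [Ordinal.opow_natCast] at hp⟩
  · rintro ⟨n, hp⟩
    exact ⟨n, Ordinal.natCast_lt_omega0 n, by rwa [Ordinal.opow_natCast]⟩

theorem pow_le_pow_of_ne_zero {κ : Ordinal.{u}} (hκ : κ ≠ 0) {m n : ℕ} (h : m ≤ n) :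
    κ ^ m ≤ κ ^ n := by
  rw [← Ordinal.opow_natCast, ← Ordinal.opow_natCast]
  exact Ordinal.opow_le_opow_right (pos_iff_ne_zero.2 hκ) (by exact_mod_cast h)

/-- The form of `powWidthRobust_lexSum` that is needed at the limit stages of the definition of
`HOpow`. The summand of index `0` is exempt, as the powerset of a point has width `1 < 2`. -/
theorem powWidthRobust_lexSum_opow {a κ : Ordinal.{u}} (ha : a ≠ 0) (hκ : κ ≠ 0)
    (A : Ordinal.{u} → Preord.{u})
    (h : ∀ β < ω ^ a, β ≠ 0 → PowWidthGE (A β) (κ ^ (ω ^ β : Ordinal.{u}))) :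
    PowWidthRobust (lexSum fun b : (ω ^ a : Ordinal.{u}).ToType => A b.toOrd.1)
      (κ ^ (ω ^ (ω ^ a : Ordinal.{u}) : Ordinal.{u})) := by
  have hl := isSuccLimit_omega0_opow ha
  have : Nonempty (ω ^ a : Ordinal.{u}).ToType :=
    Ordinal.nonempty_toType_iff.2 (Ordinal.opow_pos a Ordinal.omega0_pos).ne'
  refine powWidthRobust_lexSum fun i p hp => ?_
  obtain ⟨r, hr, hpr⟩ := (Ordinal.lt_opow_of_isSuccLimit hκ
    (isSuccLimit_omega0_opow (Ordinal.opow_pos a Ordinal.omega0_pos).ne')).1 hp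
  obtain ⟨β, hβ, hrβ⟩ := (Ordinal.lt_opow_of_isSuccLimit Ordinal.omega0_ne_zero hl).1 hr
  have hlt : max β (i.toOrd.1 + 1) < ω ^ a := max_lt hβ (hl.add_one_lt i.toOrd.2)
  have hpos : max β (i.toOrd.1 + 1) ≠ 0 :=
    ((by simp : (0 : Ordinal) < i.toOrd.1 + 1).trans_le (le_max_right _ _)).ne'
  have hj : (Ordinal.ToType.mk ⟨_, hlt⟩).toOrd.1 = max β (i.toOrd.1 + 1) := by simp
  refine ⟨Ordinal.ToType.mk ⟨_, hlt⟩, ?_, κ ^ (ω ^ max β (i.toOrd.1 + 1) : Ordinal.{u}),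
    hpr.trans_le ?_, by rw [hj]; exact h _ hlt hpos⟩
  · rw [gt_iff_lt, ← Ordinal.ToType.mk.symm.lt_iff_lt]
    have : i.toOrd.1 < max β (i.toOrd.1 + 1) := lt_max_of_lt_right (lt_add_one _)
    rw [OrderIso.symm_apply_apply]
    exact this
  · refine Ordinal.opow_le_opow_right (pos_iff_ne_zero.2 hκ) (hrβ.le.trans ?_)
    exact Ordinal.opow_le_opow_right Ordinal.omega0_pos (le_max_left _ _)

/-- The two parts are proved together: at a product `HOpow (ω ^ a) · B` with at least two factors,
the second part for `HOpow (ω ^ a)` is fed into the first part for `B`. The point `HOpow 0` is not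
robust: removing the subsets dominated by its only element leaves nothing. -/
theorem powWidthRobust_HOpow (γ : Ordinal.{u}) :
    (∀ (A : Preord.{u}) (κ : Ordinal.{u}), κ ≠ 0 → PowWidthRobust A κ →
      PowWidthRobust (lexProd A (HOpow γ)) (κ ^ (ω ^ γ : Ordinal.{u}))) ∧
    (γ ≠ 0 → PowWidthRobust (HOpow γ) (2 ^ (ω ^ γ : Ordinal.{u}) : Ordinal.{u})) := by
  induction γ using HOpow_induction with
  | zero =>
    refine ⟨fun A κ hκ hA => ?_, fun h => absurd rfl h⟩
    rw [Ordinal.opow_zero, Ordinal.opow_one]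
    refine hA.of_equiv (B := lexProd A (antichain 1))
      ⟨fun a => (a, ULift.up 0), fun p => p.1, fun _ => rfl, fun p => ?_⟩ ?_
    · exact Prod.ext rfl (ULift.ext _ _ (Subsingleton.elim _ _))
    · exact fun x y h => h.2 ⟨rfl, rfl⟩
  | one =>
    rw [Ordinal.opow_one]
    refine ⟨fun A κ hκ hA => ?_, fun _ => ?_⟩
    · refine PowWidthRobust.of_equiv ?_ (lexProdLexSum A fun n : ℕ => antichain n)
        fun _ _ => le_of_lexProdLexSum_le
      refine powWidthRobust_lexSum fun i p hp => ?_
      obtain ⟨n, hn⟩ := (lt_opow_omega0_iff hκ).1 hp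
      exact ⟨max i n + 1, by grind, κ ^ (max i n + 1),
        hn.trans_le (pow_le_pow_of_ne_zero hκ (by omega)), hA.powWidthGE_lexProd_antichain _⟩
    · refine powWidthRobust_lexSum fun i p hp => ?_
      have h2 : (2 : Ordinal.{u}) ^ ω = ω := by simpa using two_opow_omega0_mul (1 : Ordinal.{u})
      rw [h2] at hp
      obtain ⟨n, rfl⟩ := Ordinal.lt_omega0.1 hp
      exact ⟨max i n + 1, by grind, ((max i n + 1 : ℕ) : Ordinal.{u}), by
        simp only [gt_iff_lt, Nat.cast_lt]; omega, powWidthGE_of_rankGE (rankGE_antichain _)⟩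
  | opow a ha ih =>
    refine ⟨fun A κ hκ hA => ?_, fun _ => ?_⟩
    · refine PowWidthRobust.of_equiv ?_ (lexProdLexSum A _) fun _ _ => le_of_lexProdLexSum_le
      exact powWidthRobust_lexSum_opow ha hκ (fun β => lexProd A (HOpow β))
        fun β hβ _ => ((ih β hβ).1 A κ hκ hA).powWidthGE
    · exact powWidthRobust_lexSum_opow ha two_ne_zero HOpow
        fun β hβ h0 => ((ih β hβ).2 h0).powWidthGE
  | mul a δ B hA hB =>
    have h0 : (ω ^ a : Ordinal.{u}) ≠ 0 := (Ordinal.opow_pos a Ordinal.omega0_pos).ne'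
    rw [Ordinal.opow_add]
    refine ⟨fun A κ hκ h => ?_, fun _ => ?_⟩
    · rw [Ordinal.opow_mul]
      exact (hB.1 _ _ (Ordinal.opow_ne_zero _ hκ) (hA.1 A κ hκ h)).of_equiv lexProdAssoc
        fun _ _ => le_of_lexProdAssoc_le
    · rw [Ordinal.opow_mul]
      exact hB.1 _ _ (Ordinal.opow_ne_zero _ two_ne_zero) (hA.2 h0)

/-! ### Ranks of `H` and of its powerset -/

theorem sum_opow_lt_opow {c : Ordinal.{u}} {l : List Ordinal.{u}} (h : ∀ a ∈ l, a ≤ c) :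
    (l.map fun e => (ω ^ e : Ordinal.{u})).sum < ω ^ (c + 1) := by
  induction l with
  | nil => simpa using Ordinal.opow_pos (c + 1) Ordinal.omega0_pos
  | cons a l ih =>
    rw [List.map_cons, List.sum_cons]
    refine Ordinal.isPrincipal_add_omega0_opow _ ?_ (ih fun b hb => h b (List.mem_cons_of_mem _ hb))
    exact (Ordinal.opow_lt_opow_iff_right Ordinal.one_lt_omega0).2
      (Order.lt_add_one_iff.2 (h a (by simp)))

theorem rankLE_disjSumList_HOpow {l : List Ordinal.{u}} (hl : l.Pairwise (· ≥ ·)) :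
    RankLE Bad (univ : Set (disjSumList (l.map HOpow)))
      (l.map fun e => (ω ^ e : Ordinal.{u})).sum := by
  induction l with
  | nil =>
    rw [rankLE_iff]
    exact fun x => x.down.elim0
  | cons a l ih =>
    rw [List.pairwise_cons] at hl
    match l, ih, hl with
    | [], _, _ =>
      simp only [List.map_cons, List.map_nil, List.sum_singleton]
      exact rankLE_HOpow a
    | b :: l, ih, hl =>
      exact rankLE_disjSum (rankLE_HOpow a) (ih hl.2)
        (natSumLE_opow_add (sum_opow_lt_opow fun e he => hl.1 e he))

theorem rankGE_disjSumList_HOpow (l : List Ordinal.{u}) :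
    RankGE Incomp (univ : Set (disjSumList (l.map HOpow)))
      (l.map fun e => (ω ^ e : Ordinal.{u})).sum := by
  induction l with
  | nil => exact RankGE.zero
  | cons a l ih =>
    match l, ih with
    | [], _ =>
      simp only [List.map_cons, List.map_nil, List.sum_singleton]
      exact rankGE_HOpow a
    | b :: l, ih => exact rankGE_disjSum (rankGE_HOpow a) ih

theorem prod_two_opow (l : List Ordinal.{u}) :
    (l.map fun e => (2 ^ (ω ^ e : Ordinal.{u}) : Ordinal.{u})).prod =
      2 ^ (l.map fun e => (ω ^ e : Ordinal.{u})).sum := by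
  induction l with
  | nil => simp
  | cons a l ih => simp [ih, Ordinal.opow_add]

theorem rankLE_H (α : Ordinal.{u}) : RankLE Bad (univ : Set (H α)) α := by
  have := rankLE_disjSumList_HOpow (sorted_cnfExponents α)
  rwa [sum_cnfExponents] at this

theorem rankGE_H (α : Ordinal.{u}) : RankGE Incomp (univ : Set (H α)) α := by
  have := rankGE_disjSumList_HOpow (cnfExponents α)
  rwa [sum_cnfExponents] at this

theorem rankLE_finset_H (α : Ordinal.{u}) : RankLE PBad (univ : Set (Finset (H α))) (2 ^ α) :=
  (rankLE_finset (rankLE_H α)).mono (fun _ _ => subset_univ _) le_rfl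

theorem rankGE_pBad_HOpow (γ : Ordinal.{u}) :
    RankGE PBad (univ : Set (Finset (HOpow γ))) (2 ^ (ω ^ γ : Ordinal.{u}) : Ordinal.{u}) := by
  by_cases h0 : γ = 0
  · subst h0
    rw [Ordinal.opow_zero, Ordinal.opow_one, rankGE_iff]
    obtain ⟨x⟩ : Nonempty (HOpow.{u} 0) := by rw [HOpow_zero]; exact ⟨ULift.up 0⟩
    intro p hp
    have h : RankGE PBad {T : Finset (HOpow.{u} 0) | T ∈ univ ∧ PBad {x} T} (1 : Ordinal.{u}) := by
      refine RankGE.one ⟨∅, mem_univ _, fun h => ?_⟩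
      obtain ⟨b, hb, -⟩ := h x (by simp)
      exact absurd hb (Finset.notMem_empty b)
    refine ⟨{x}, mem_univ _, h.mono subset_rfl ?_⟩
    rwa [← one_add_one_eq_two, Order.lt_add_one_iff] at hp
  · exact ((powWidthRobust_HOpow γ).2 h0).powWidthGE.rankGE_pBad

theorem rankGE_pBad_H (α : Ordinal.{u}) :
    RankGE PBad (univ : Set (Finset (H α))) (2 ^ α : Ordinal.{u}) := by
  have := rankGE_pBad_disjSumList (cnfExponents α) HOpow
    (fun e => (2 ^ (ω ^ e : Ordinal.{u}) : Ordinal.{u})) fun i _ => rankGE_pBad_HOpow i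
  rwa [prod_two_opow, sum_cnfExponents] at this

theorem cnfExponents_natCast (k : ℕ) : cnfExponents (k : Ordinal.{u}) = List.replicate k 0 := by
  have hs := sum_cnfExponents (k : Ordinal.{u})
  have h0 : ∀ a ∈ cnfExponents (k : Ordinal.{u}), a = 0 := by
    intro a ha
    by_contra h
    have h1 : (ω ^ a : Ordinal.{u}) ≤ k := by
      rw [← hs]
      exact List.le_sum_of_mem (List.mem_map_of_mem ha)
    exact absurd (h1.trans_lt (Ordinal.natCast_lt_omega0 k))
      (not_lt.2 (Ordinal.left_le_opow ω (pos_iff_ne_zero.2 h)))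
  have h1 := List.eq_replicate_of_mem h0
  rw [h1] at hs
  simp only [List.map_replicate, Ordinal.opow_zero, List.sum_replicate, nsmul_one] at hs
  rw [h1, Nat.cast_inj.1 hs]

theorem rankGE_pIncomp_H {α : Ordinal.{u}} (hα : ω ≤ α) :
    RankGE PIncomp (univ : Set (Finset (H α))) (2 ^ α : Ordinal.{u}) := by
  have hs := sum_cnfExponents α
  have hsort := sorted_cnfExponents α
  have key : ∀ l, cnfExponents α = l →
      RankGE PIncomp (univ : Set (Finset (disjSumList (l.map HOpow)))) (2 ^ α : Ordinal.{u}) := by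
    intro l hl
    rw [hl] at hs hsort
    match l with
    | [] => exact absurd hα (by rw [← hs]; simp)
    | a :: l =>
      have ha : a ≠ 0 := by
        rintro rfl
        have h0 : ∀ b ∈ (0 : Ordinal.{u}) :: l, b ≤ 0 := by
          intro b hb
          rcases List.mem_cons.1 hb with rfl | hb
          exacts [le_rfl, (List.pairwise_cons.1 hsort).1 b hb]
        have := sum_opow_lt_opow h0
        rw [hs, zero_add, Ordinal.opow_one] at this
        exact absurd this (not_lt.2 hα)
      have := PowWidthRobust.disjSumList (l := l) ((powWidthRobust_HOpow a).2 ha)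
        (q := fun e => (2 ^ (ω ^ e : Ordinal.{u}) : Ordinal.{u})) fun i _ => rankGE_pBad_HOpow i
      rw [prod_two_opow, hs] at this
      exact RankGE.mono this.powWidthGE (subset_univ _) le_rfl
  exact key _ rfl

/-- The disjoint sum of `k` points is an antichain with `k` elements. -/
theorem disjSumList_replicate_eq_of_le_and_equiv (k : ℕ) :
    (∀ x y : disjSumList (List.replicate k (antichain.{u} 1)), x ≤ y → x = y) ∧
      Nonempty (disjSumList (List.replicate k (antichain.{u} 1)) ≃ Fin k) := by
  induction k with
  | zero => exact ⟨fun _ _ h => h, ⟨Equiv.ulift⟩⟩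
  | succ k ih =>
    match k, ih with
    | 0, _ => exact ⟨fun _ _ h => h, ⟨Equiv.ulift⟩⟩
    | k + 1, ⟨h, ⟨e⟩⟩ =>
      refine ⟨fun x y hxy => ?_, ⟨((Equiv.sumCongr Equiv.ulift e).trans finSumFinEquiv).trans
        (finCongr (by omega))⟩⟩
      cases hxy with
      | inl h' => exact congrArg _ h'
      | inr h' => exact congrArg _ (h _ _ h')

theorem exists_equiv_antichain_H (k : ℕ) :
    ∃ e : H (k : Ordinal.{u}) ≃ antichain.{u} k, ∀ x y, x ≤ y ↔ e x ≤ e y := by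
  have : H (k : Ordinal.{u}) = disjSumList (List.replicate k (antichain 1)) := by
    rw [H, cnfExponents_natCast, List.map_replicate, HOpow_zero]
  rw [this]
  obtain ⟨h, ⟨e⟩⟩ := disjSumList_replicate_eq_of_le_and_equiv.{u} k
  refine ⟨e.trans Equiv.ulift.symm, fun x y => ⟨fun hxy => ?_, fun hxy => ?_⟩⟩
  · rw [h x y hxy]
  · exact ((e.trans Equiv.ulift.symm).injective hxy).le

theorem width_finPowerset_H_natCast (k : ℕ) :
    width (finPowerset (H (k : Ordinal.{u}))) = width (finPowerset (antichain.{u} k)) := by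
  classical
  obtain ⟨e, he⟩ := exists_equiv_antichain_H.{u} k
  have hle : RankLE PIncomp (univ : Set (Finset (H (k : Ordinal.{u})))) (2 ^ (k : Ordinal.{u})) :=
    (rankLE_finset_H _).comap id (mapsTo_univ _ _) (fun _ _ _ _ h => h.1) le_rfl
  have h1 : ∀ x y, e x ≤ e y → x ≤ y := fun x y => (he x y).2
  have h2 : ∀ x y, e.symm x ≤ e.symm y → x ≤ y := fun x y h => by simpa using (he _ _).1 h
  exact treeRank_congr hle
    (fun T => T.image e) (fun S T h => ⟨fun h' => h.1 (dom_of_dom_image h1 h'),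
      fun h' => h.2 (dom_of_dom_image h1 h')⟩)
    (fun T => T.image e.symm) (fun S T h => ⟨fun h' => h.1 (dom_of_dom_image h2 h'),
      fun h' => h.2 (dom_of_dom_image h2 h')⟩)

end PfTight

theorem mainTheorem4 (α : Ordinal.{u}) :
    WellQuasiOrderedLE (PfTight.H α) ∧
    PfTight.mot (PfTight.H α) = α ∧
    PfTight.width (PfTight.H α) = α ∧
    WellQuasiOrderedLE (PfTight.finPowerset (PfTight.H α)) ∧
    PfTight.mot (PfTight.finPowerset (PfTight.H α)) = 2 ^ α ∧
    (ω ≤ α → PfTight.width (PfTight.finPowerset (PfTight.H α)) = 2 ^ α) ∧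
    (∀ k : ℕ, α = k → PfTight.width (PfTight.finPowerset (PfTight.H α)) =
      PfTight.width (PfTight.finPowerset (PfTight.antichain.{u} k))) := by
  open PfTight Set in
  have hle := rankLE_H α
  have hge := rankGE_H α
  have hle' := rankLE_finset_H α
  refine ⟨wellQuasiOrderedLE_of_rankLE hle, treeRank_eq hle ?_, treeRank_eq ?_ hge,
    wellQuasiOrderedLE_of_rankLE (A := finPowerset (H α)) hle',
    treeRank_eq hle' (rankGE_pBad_H α), fun hα => treeRank_eq ?_ (rankGE_pIncomp_H hα), ?_⟩
  · exact hge.map id (mapsTo_univ _ _) (fun _ _ _ _ h => h.1) le_rfl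
  · exact hle.comap id (mapsTo_univ _ _) (fun _ _ _ _ h => h.1) le_rfl
  · exact hle'.comap id (mapsTo_univ _ _) (fun _ _ _ _ h => h.1) le_rfl
  · rintro k rfl
    exact width_finPowerset_H_natCast k
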